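/- Let $\mathcal{M}=(M,\nabla)$ be a simply connected affine surface, i.e. $M$ is a smooth (connected and) simply connected surface and $\nabla$ is a smooth torsion free connection on the tangent bundle $TM$. Let $R(X,Y)Z=\nabla_X\nabla_YZ-\nabla_Y\nabla_XZ-\nabla_{[X,Y]}Z$ be the curvature, $\rho(X,Y)=\operatorname{Tr}\{Z\mapsto R(Z,X)Y\}$ the Ricci tensor, and $\rho_s(X,Y)=\frac12\{\rho(X,Y)+\rho(Y,X)\}$ the symmetric Ricci tensor. Suppose that $\rho_s\neq0$ at every point of $M$. A smooth tensor field $T$ of type $(1,1)$ is parallel if $\nabla T=0$. A trace free parallel $T$ is called a Kähler structure if $T^2=-\operatorname{id}$, a para-Kähler structure if $T^2=\operatorname{id}$, and a nilpotent Kähler structure if $T\neq0$ and $T^2=0$. The tensor $\rho_s$ is recurrent if $\nabla\rho_s=\omega\otimes\rho_s$ for some smooth $1$-form $\omega$ on $M$. The sign of $\det\rho_s$ at a point means the sign of the determinant of the matrix of $\rho_s$ in any basis of the tangent space at that point. Then: 1. $\mathcal{M}$ admits a Kähler structure if and only if $\det\rho_s>0$ at every point of $M$ and $\rho_s$ is recurrent.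 2. $\mathcal{M}$ admits a para-Kähler structure if and only if $\det\rho_s<0$ at every point of $M$ and $\rho_s$ is recurrent. 3. $\mathcal{M}$ admits a nilpotent Kähler structure if and only if $\rho_s$ has rank one at every point of $M$ and $\rho_s$ is recurrent. -/

import Mathlib

open Bundle Set Filter FiberBundle VectorField
open scoped Manifold ContDiff Topology

noncomputable section

namespace AffineManifold

/-- The model vector space of an `n`-dimensional manifold. -/
local notation "𝔼" n:max => EuclideanSpace ℝ (Fin n)

variable {n : ℕ} {M : Type*} [TopologicalSpace M] [ChartedSpace (𝔼 n) M]
  [IsManifold (𝓡 n) ∞ M]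

/-- A smooth vector field on `M`. -/
def SmoothVectorField (X : Π x : M, TangentSpace (𝓡 n) x) : Prop :=
  ContMDiff (𝓡 n) ((𝓡 n).prod 𝓘(ℝ, 𝔼 n)) ∞
    (fun x ↦ (TotalSpace.mk' (𝔼 n) x (X x) : TangentBundle (𝓡 n) M))

/-- A smooth tensor field of type (1,1) on `M`, i.e. a smooth section of the bundle of
endomorphisms of the tangent bundle. -/
def SmoothEndomorphismField
    (T : Π x : M, TangentSpace (𝓡 n) x →L[ℝ] TangentSpace (𝓡 n) x) : Prop :=
  ContMDiff (𝓡 n) ((𝓡 n).prod 𝓘(ℝ, 𝔼 n →L[ℝ] 𝔼 n)) ∞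
    (fun x ↦ TotalSpace.mk' (𝔼 n →L[ℝ] 𝔼 n)
      (E := fun x : M ↦ TangentSpace (𝓡 n) x →L[ℝ] TangentSpace (𝓡 n) x) x (T x))

/-- A smooth 1-form on `M`, i.e. a smooth section of the cotangent bundle. -/
def SmoothOneForm (η : Π x : M, TangentSpace (𝓡 n) x →L[ℝ] ℝ) : Prop :=
  ContMDiff (𝓡 n) ((𝓡 n).prod 𝓘(ℝ, 𝔼 n →L[ℝ] ℝ)) ∞
    (fun x ↦ TotalSpace.mk' (𝔼 n →L[ℝ] ℝ)
      (E := fun x : M ↦ TangentSpace (𝓡 n) x →L[ℝ] ℝ) x (η x))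

variable (cov : CovariantDerivative (𝓡 n) (𝔼 n) (TangentSpace (𝓡 n) : M → Type _))

/-- The expression `∇_X ∇_Y Z - ∇_Y ∇_X Z - ∇_[X,Y] Z` at `x`, for vector fields `X`, `Y`, `Z`.
Recall that `cov Z x v` is `∇_v Z` at `x`. -/
def curvatureOfFields (X Y Z : Π x : M, TangentSpace (𝓡 n) x) (x : M) : TangentSpace (𝓡 n) x :=
  cov (fun y ↦ cov Z y (Y y)) x (X x) - cov (fun y ↦ cov Z y (X y)) x (Y x)
    - cov Z x (mlieBracket (𝓡 n) X Y x)

variable {cov}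

lemma mdifferentiableAt_cov_of_contMDiffOn [T2Space M]
    [hcov : cov.ContMDiffCovariantDerivative ∞] {x : M} {Z : Π x : M, TangentSpace (𝓡 n) x}
    {u : Set M} (hu : u ∈ 𝓝 x)
    (hZ : ContMDiffOn (𝓡 n) ((𝓡 n).prod 𝓘(ℝ, 𝔼 n)) ∞
      (fun x ↦ (TotalSpace.mk' (𝔼 n) x (Z x) : TangentBundle (𝓡 n) M)) u) :
    MDifferentiableAt (𝓡 n) ((𝓡 n).prod 𝓘(ℝ, 𝔼 n →L[ℝ] 𝔼 n))
      (fun y ↦ TotalSpace.mk' (𝔼 n →L[ℝ] 𝔼 n)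
        (E := fun y : M ↦ TangentSpace (𝓡 n) y →L[ℝ] TangentSpace (𝓡 n) y) y (cov Z y)) x := by
  obtain ⟨v, hvu, hvo, hxv⟩ := mem_nhds_iff.mp hu
  obtain ⟨f, -, hf⟩ := (SmoothBumpFunction.nhds_basis_tsupport (I := 𝓡 n) x).mem_iff.mp
    (hvo.mem_nhds hxv)
  have hZv := hZ.mono hvu
  have hsm := ContMDiffOn.smul_section_of_tsupport (f.contMDiff.contMDiffOn (s := v)) hvo hf hZv
  have hc := hcov.contMDiff.contMDiff (σ := (f : M → ℝ) • Z) hsm.contMDiffOn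
  have hcx := (hc.contMDiffAt (x := x) univ_mem).mdifferentiableAt (by simp)
  refine hcx.congr_of_eventuallyEq ?_
  have hZd : ∀ y ∈ v, MDifferentiableAt (𝓡 n) ((𝓡 n).prod 𝓘(ℝ, 𝔼 n))
      (fun x ↦ (TotalSpace.mk' (𝔼 n) x (Z x) : TangentBundle (𝓡 n) M)) y := fun y hy ↦
    (hZv.contMDiffAt (hvo.mem_nhds hy)).mdifferentiableAt (by simp)
  filter_upwards [hvo.mem_nhds hxv, f.eventuallyEq_one.eventually_nhds] with y hy hy1
  congr 1
  refine cov.isCovariantDerivativeOnUniv.congr_of_eventuallyEq (hZd y hy)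
    (hsm.contMDiffAt.mdifferentiableAt (by simp)) univ_mem ?_
  filter_upwards [hy1] with z hz
  simp [hz]

lemma mdifferentiableAt_cov_extend [T2Space M]
    [hcov : cov.ContMDiffCovariantDerivative ∞] {x : M} (w : TangentSpace (𝓡 n) x) :
    MDifferentiableAt (𝓡 n) ((𝓡 n).prod 𝓘(ℝ, 𝔼 n →L[ℝ] 𝔼 n))
      (fun y ↦ TotalSpace.mk' (𝔼 n →L[ℝ] 𝔼 n)
        (E := fun y : M ↦ TangentSpace (𝓡 n) y →L[ℝ] TangentSpace (𝓡 n) y) y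
        (cov (extend (𝔼 n) w) y)) x := by
  obtain ⟨u, hu, h⟩ := exists_contMDiffOn_extend (k := ∞) (𝓡 n) (𝔼 n) w
  exact mdifferentiableAt_cov_of_contMDiffOn hu h

lemma tensorialAt_curvatureOfFields_left [T2Space M]
    [hcov : cov.ContMDiffCovariantDerivative ∞] {x : M}
    (w : TangentSpace (𝓡 n) x) (Y : Π x : M, TangentSpace (𝓡 n) x) :
    TensorialAt (𝓡 n) (𝔼 n) (fun X ↦ curvatureOfFields cov X Y (extend (𝔼 n) w) x) x where
  smul := by
    intro f X hf hX
    have h := (mdifferentiableAt_cov_extend (cov := cov) w).clm_bundle_apply hX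
    have h1 := cov.isCovariantDerivativeOnUniv.leibniz h hf
    have h2 : (fun y ↦ cov (extend (𝔼 n) w) y ((f • X) y)) =
      f • (fun y ↦ cov (extend (𝔼 n) w) y (X y)) := by
      ext1 y; simp
    simp only [curvatureOfFields, h2, h1, mlieBracket_smul_left hf hX]
    simp
    module
  add := by
    intro X X' hX hX'
    have h := (mdifferentiableAt_cov_extend (cov := cov) w).clm_bundle_apply hX
    have h' := (mdifferentiableAt_cov_extend (cov := cov) w).clm_bundle_apply hX'
    have h1 := cov.isCovariantDerivativeOnUniv.add h h'
    have h2 : (fun y ↦ cov (extend (𝔼 n) w) y ((X + X') y)) =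
      (fun y ↦ cov (extend (𝔼 n) w) y (X y)) +
      (fun y ↦ cov (extend (𝔼 n) w) y (X' y)) := by
      ext1 y; simp
    simp only [curvatureOfFields, h2, h1, mlieBracket_add_left hX hX']
    simp
    module

lemma curvatureOfFields_swap (X Y Z : Π x : M, TangentSpace (𝓡 n) x) (x : M) :
    curvatureOfFields cov X Y Z x = - curvatureOfFields cov Y X Z x := by
  simp only [curvatureOfFields]
  rw [mlieBracket_swap_apply (V := X)]
  simp only [map_neg]
  module

lemma tensorialAt_curvatureOfFields_right [T2Space M]
    [hcov : cov.ContMDiffCovariantDerivative ∞] {x : M}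
    (w : TangentSpace (𝓡 n) x) (X : Π x : M, TangentSpace (𝓡 n) x) :
    TensorialAt (𝓡 n) (𝔼 n) (fun Y ↦ curvatureOfFields cov X Y (extend (𝔼 n) w) x) x where
  smul := by
    intro f Y hf hY
    have := (tensorialAt_curvatureOfFields_left (cov := cov) w X).smul hf hY
    simp only [curvatureOfFields_swap X, this, smul_neg]
  add := by
    intro Y Y' hY hY'
    have := (tensorialAt_curvatureOfFields_left (cov := cov) w X).add hY hY'
    simp only [curvatureOfFields_swap X, this, neg_add]

lemma eventually_extend_add {x : M} (w w' : TangentSpace (𝓡 n) x) :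
    ∀ᶠ y in 𝓝 x, extend (𝔼 n) (w + w') y = (extend (𝔼 n) w + extend (𝔼 n) w') y := by
  have hx := FiberBundle.mem_baseSet_trivializationAt' (F := 𝔼 n) (E := TangentSpace (𝓡 n)) x
  simp only [extend, Pi.add_apply]
  set t := trivializationAt (𝔼 n) (TangentSpace (𝓡 n)) x
  filter_upwards [t.open_baseSet.mem_nhds hx] with y hy
  rw [(t.linear ℝ hx).map_add]
  simp only [← t.coe_symmₗ (R := ℝ) hy, map_add]

lemma eventually_extend_smul {x : M} (c : ℝ) (w : TangentSpace (𝓡 n) x) :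
    ∀ᶠ y in 𝓝 x, extend (𝔼 n) (c • w) y = (c • extend (𝔼 n) w) y := by
  have hx := FiberBundle.mem_baseSet_trivializationAt' (F := 𝔼 n) (E := TangentSpace (𝓡 n)) x
  simp only [extend, Pi.smul_apply]
  set t := trivializationAt (𝔼 n) (TangentSpace (𝓡 n)) x
  filter_upwards [t.open_baseSet.mem_nhds hx] with y hy
  rw [(t.linear ℝ hx).map_smul]
  simp only [← t.coe_symmₗ (R := ℝ) hy, map_smul]

variable [T2Space M]

/-- The curvature of a smooth connection at `x`, with the differentiated vector first:
`curvature cov x w u v = R(u, v) w`, where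
`R(X, Y) Z = ∇_X ∇_Y Z - ∇_Y ∇_X Z - ∇_[X,Y] Z`. It is computed by extending the three tangent
vectors to vector fields; `extend` is the extension with constant coefficients in the preferred
chart at `x`, which is smooth near `x`. -/
def curvature (cov : CovariantDerivative (𝓡 n) (𝔼 n) (TangentSpace (𝓡 n) : M → Type _))
    [hcov : cov.ContMDiffCovariantDerivative ∞] (x : M) :
    TangentSpace (𝓡 n) x →ₗ[ℝ]
      (TangentSpace (𝓡 n) x →L[ℝ] TangentSpace (𝓡 n) x →L[ℝ] TangentSpace (𝓡 n) x) where
  toFun w := TensorialAt.mkHom₂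
    (fun X Y ↦ curvatureOfFields cov X Y (extend (𝔼 n) w) x) x
    (fun Y _ ↦ tensorialAt_curvatureOfFields_left w Y)
    (fun X _ ↦ tensorialAt_curvatureOfFields_right w X)
  map_add' w w' := by
    ext1 u
    ext1 v
    simp only [TensorialAt.mkHom₂_apply_eq_extend, add_apply]
    have hd (w u : TangentSpace (𝓡 n) x) := (mdifferentiableAt_cov_extend (cov := cov)
      w).clm_bundle_apply (mdifferentiableAt_extend (𝓡 n) (𝔼 n) u)
    have he : ∀ᶠ y in 𝓝 x, cov (extend (𝔼 n) (w + w')) y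
        = cov (extend (𝔼 n) w) y + cov (extend (𝔼 n) w') y := by
      obtain ⟨s, hs, h⟩ := exists_mdifferentiableOn_extend (𝓡 n) (𝔼 n) w
      obtain ⟨s', hs', h'⟩ := exists_mdifferentiableOn_extend (𝓡 n) (𝔼 n) w'
      obtain ⟨s₀, hs₀, h₀⟩ := exists_mdifferentiableOn_extend (𝓡 n) (𝔼 n) (w + w')
      filter_upwards [eventually_mem_nhds_iff.mpr hs, eventually_mem_nhds_iff.mpr hs',
        eventually_mem_nhds_iff.mpr hs₀, (eventually_extend_add w w').eventually_nhds]
        with y hy hy' hy₀ hadd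
      have d := (h y (mem_of_mem_nhds hy)).mdifferentiableAt hy
      have d' := (h' y (mem_of_mem_nhds hy')).mdifferentiableAt hy'
      rw [← cov.isCovariantDerivativeOnUniv.add d d']
      exact cov.isCovariantDerivativeOnUniv.congr_of_eventuallyEq
        ((h₀ y (mem_of_mem_nhds hy₀)).mdifferentiableAt hy₀)
        (mdifferentiableAt_add_section d d') univ_mem hadd
    have key (u : TangentSpace (𝓡 n) x) :
        cov (fun y ↦ cov (extend (𝔼 n) (w + w')) y (extend (𝔼 n) u y)) x
          = cov (fun y ↦ cov (extend (𝔼 n) w) y (extend (𝔼 n) u y)) x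
            + cov (fun y ↦ cov (extend (𝔼 n) w') y (extend (𝔼 n) u y)) x := by
      rw [← cov.isCovariantDerivativeOnUniv.add (hd w u) (hd w' u)]
      refine cov.isCovariantDerivativeOnUniv.congr_of_eventuallyEq (hd (w + w') u)
        (mdifferentiableAt_add_section (hd w u) (hd w' u)) univ_mem ?_
      filter_upwards [he] with y hy
      simp [hy]
    simp only [curvatureOfFields, key, he.self_of_nhds, add_apply]
    module
  map_smul' c w := by
    ext1 u
    ext1 v
    simp only [TensorialAt.mkHom₂_apply_eq_extend, smul_apply,
      RingHom.id_apply]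
    have hd (w u : TangentSpace (𝓡 n) x) := (mdifferentiableAt_cov_extend (cov := cov)
      w).clm_bundle_apply (mdifferentiableAt_extend (𝓡 n) (𝔼 n) u)
    have he : ∀ᶠ y in 𝓝 x, cov (extend (𝔼 n) (c • w)) y = c • cov (extend (𝔼 n) w) y := by
      obtain ⟨s, hs, h⟩ := exists_mdifferentiableOn_extend (𝓡 n) (𝔼 n) w
      obtain ⟨s₀, hs₀, h₀⟩ := exists_mdifferentiableOn_extend (𝓡 n) (𝔼 n) (c • w)
      filter_upwards [eventually_mem_nhds_iff.mpr hs, eventually_mem_nhds_iff.mpr hs₀,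
        (eventually_extend_smul c w).eventually_nhds] with y hy hy₀ hsmul
      have d := (h y (mem_of_mem_nhds hy)).mdifferentiableAt hy
      rw [← cov.isCovariantDerivativeOnUniv.smul_const c d]
      exact cov.isCovariantDerivativeOnUniv.congr_of_eventuallyEq
        ((h₀ y (mem_of_mem_nhds hy₀)).mdifferentiableAt hy₀)
        d.smul_const_section univ_mem hsmul
    have key (u : TangentSpace (𝓡 n) x) :
        cov (fun y ↦ cov (extend (𝔼 n) (c • w)) y (extend (𝔼 n) u y)) x
          = c • cov (fun y ↦ cov (extend (𝔼 n) w) y (extend (𝔼 n) u y)) x := by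
      rw [← cov.isCovariantDerivativeOnUniv.smul_const c (hd w u)]
      refine cov.isCovariantDerivativeOnUniv.congr_of_eventuallyEq (hd (c • w) u)
        (hd w u).smul_const_section univ_mem ?_
      filter_upwards [he] with y hy
      simp [hy]
    simp only [curvatureOfFields, key, he.self_of_nhds, smul_apply]
    module

variable (cov : CovariantDerivative (𝓡 n) (𝔼 n) (TangentSpace (𝓡 n) : M → Type _))
  [hcov : cov.ContMDiffCovariantDerivative ∞]

/-- The endomorphism `z ↦ R(z, u) v` of the tangent space at `x`. -/
def curvatureEndomorphism (x : M) (u v : TangentSpace (𝓡 n) x) :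
    TangentSpace (𝓡 n) x →ₗ[ℝ] TangentSpace (𝓡 n) x where
  toFun z := curvature cov x v z u
  map_add' z z' := by rw [map_add, add_apply]
  map_smul' c z := by rw [map_smul, smul_apply, RingHom.id_apply]

/-- The Ricci tensor `ρ(u, v) = Tr {z ↦ R(z, u) v}`. -/
def ricci (x : M) : LinearMap.BilinForm ℝ (TangentSpace (𝓡 n) x) :=
  LinearMap.mk₂ ℝ
    (fun u v ↦ LinearMap.trace ℝ (TangentSpace (𝓡 n) x) (curvatureEndomorphism cov x u v))
    (fun u u' v ↦ by
      rw [← map_add]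
      exact congrArg _ (LinearMap.ext fun z ↦ map_add (curvature cov x v z) u u'))
    (fun c u v ↦ by
      rw [← map_smul]
      exact congrArg _ (LinearMap.ext fun z ↦ map_smul (curvature cov x v z) c u))
    (fun u v v' ↦ by
      rw [← map_add]
      refine congrArg _ (LinearMap.ext fun z ↦ ?_)
      change curvature cov x (v + v') z u = curvature cov x v z u + curvature cov x v' z u
      rw [map_add, add_apply, add_apply])
    (fun c u v ↦ by
      rw [← map_smul]
      refine congrArg _ (LinearMap.ext fun z ↦ ?_)
      change curvature cov x (c • v) z u = c • curvature cov x v z u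
      rw [map_smul, smul_apply, smul_apply])

/-- The symmetric Ricci tensor `ρ_s(u, v) = (ρ(u, v) + ρ(v, u)) / 2`. -/
def ricciSymm (x : M) : LinearMap.BilinForm ℝ (TangentSpace (𝓡 n) x) :=
  (1 / 2 : ℝ) • (ricci cov x + (ricci cov x).flip)

/-- A tensor field of type (1,1) is parallel if `(∇_v T) Y = ∇_v (T Y) - T (∇_v Y)` vanishes for all
tangent vectors `v` and all smooth vector fields `Y`. -/
def IsParallel (T : Π x : M, TangentSpace (𝓡 n) x →L[ℝ] TangentSpace (𝓡 n) x) : Prop :=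
  ∀ Y : Π x : M, TangentSpace (𝓡 n) x, SmoothVectorField Y →
    ∀ (x : M) (v : TangentSpace (𝓡 n) x),
      cov (fun y ↦ T y (Y y)) x v - T x (cov Y x v) = 0

/-- The trace free parallel smooth tensor fields of type (1,1). -/
structure IsTraceFreeParallel
    (T : Π x : M, TangentSpace (𝓡 n) x →L[ℝ] TangentSpace (𝓡 n) x) : Prop where
  smooth : SmoothEndomorphismField T
  parallel : IsParallel cov T
  traceFree : ∀ x, LinearMap.trace ℝ (TangentSpace (𝓡 n) x) (T x) = 0

/-- There is a Kähler structure: a trace free parallel `T` with `T² = -id`. -/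
def AdmitsKahler : Prop :=
  ∃ T : Π x : M, TangentSpace (𝓡 n) x →L[ℝ] TangentSpace (𝓡 n) x,
    IsTraceFreeParallel cov T ∧ ∀ x v, T x (T x v) = -v

/-- There is a para-Kähler structure: a trace free parallel `T` with `T² = id`. -/
def AdmitsParaKahler : Prop :=
  ∃ T : Π x : M, TangentSpace (𝓡 n) x →L[ℝ] TangentSpace (𝓡 n) x,
    IsTraceFreeParallel cov T ∧ ∀ x v, T x (T x v) = v

/-- There is a nilpotent Kähler structure: a trace free parallel `T ≠ 0` with `T² = 0`. -/
def AdmitsNilpotentKahler : Prop :=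
  ∃ T : Π x : M, TangentSpace (𝓡 n) x →L[ℝ] TangentSpace (𝓡 n) x,
    IsTraceFreeParallel cov T ∧ T ≠ 0 ∧ ∀ x v, T x (T x v) = 0

/-- A field `B` of bilinear forms is recurrent if `∇ B = η ⊗ B` for some smooth 1-form `η`, where
`(∇_v B)(Y, Z) = v (B(Y, Z)) - B(∇_v Y, Z) - B(Y, ∇_v Z)`. -/
def IsRecurrent (B : Π x : M, LinearMap.BilinForm ℝ (TangentSpace (𝓡 n) x)) : Prop :=
  ∃ η : Π x : M, TangentSpace (𝓡 n) x →L[ℝ] ℝ, SmoothOneForm η ∧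
    ∀ Y Z : Π x : M, TangentSpace (𝓡 n) x, SmoothVectorField Y → SmoothVectorField Z →
      ∀ (x : M) (v : TangentSpace (𝓡 n) x),
        mvfderiv (𝓡 n) (fun y ↦ B y (Y y) (Z y)) x v
          - B x (cov Y x v) (Z x) - B x (Y x) (cov Z x v) = η x v * B x (Y x) (Z x)

end AffineManifold

end

/-! On a surface the curvature operators are `R(u, v) = α(u, v) R₁₂`, where `α` is the area form of
a chart and `R₁₂` a single endomorphism. Let `S` be the trace free part of `R₁₂` (`coordRicciEnd`).
Then `ρ_s(u, v) = α(S v, u)` (`ricciSymm_eq`), so up to the choice of an area form, i.e. up to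
scale, the symmetric Ricci tensor is a trace free endomorphism; `Represents` expresses this without
a chart. Moreover, `S` commutes with all curvature operators, and an endomorphism commutes with the
curvature iff it commutes with `S`.

A trace free parallel `T` commutes with the curvature, hence with `S`, and commuting trace free
endomorphisms of a plane are proportional. So a nowhere zero `T` represents `ρ_s`
(`represents_of_parallel`). Differentiating `[S, T] = 0` shows that `∇S` is also proportional to
`T`, hence to `S`, which makes `ρ_s` recurrent (`isRecurrent_of_parallel`).

Conversely, if `ρ_s` is recurrent, then in a chart `∇S = β ⊗ S`, where `β` is the given form plus
the trace of the connection form, because `α` need not be parallel. The Ricci identity `[R(u, v), S]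
= dβ(u, v) S` (`coordCurvature_commutator_of_recurrent`) forces `dβ = 0`; on a ball `β = df`, and
`exp(-f) S` is parallel. Two such local fields differ by a locally constant nonzero factor, so over
a simply connected surface they can be rescaled to a global parallel `T` representing `ρ_s`
(`exists_parallel_represents`).

For a trace free `T` the square is scalar, and parallelism makes it one constant `c` on the
connected surface. Since `det ρ_s` is a negative multiple of `c` (`Represents.det_toMatrix`), the
sign of `c` distinguishes the three cases, and division by `√|c|` normalizes `T` when `c ≠ 0`. -/

noncomputable section

set_option maxSynthPendingDepth 3

namespace AffineManifold

/-! ### Bilinear forms and trace free endomorphisms of a plane. -/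

section LinearAlgebra

variable {W : Type*} [AddCommGroup W] [Module ℝ W]

/-- `B u v = α (T v) u` for some nonzero alternating form `α`: the endomorphism `T` is one of
those obtained from the bilinear form `B` by raising an index with an area form. -/
def Represents (B : LinearMap.BilinForm ℝ W) (T : W →ₗ[ℝ] W) : Prop :=
  ∃ α : LinearMap.BilinForm ℝ W, α.IsAlt ∧ α ≠ 0 ∧ ∀ u v, B u v = α (T v) u

lemma isAlt_apply_eq_of_basis (b : Module.Basis (Fin 2) ℝ W) {α : LinearMap.BilinForm ℝ W}
    (hα : α.IsAlt) (u v : W) :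
    α u v = α (b 0) (b 1) * (b.repr u 0 * b.repr v 1 - b.repr u 1 * b.repr v 0) := by
  conv_lhs => rw [← b.sum_repr u, ← b.sum_repr v]
  have h : α (b 1) (b 0) = - α (b 0) (b 1) := (hα.neg_eq _ _).symm
  simp only [Fin.sum_univ_two, map_add, map_smul, LinearMap.add_apply, LinearMap.smul_apply,
    smul_eq_mul, hα.self_eq_zero, h]
  ring

lemma isAlt_basis_ne_zero (b : Module.Basis (Fin 2) ℝ W) {α : LinearMap.BilinForm ℝ W}
    (hα : α.IsAlt) (h0 : α ≠ 0) : α (b 0) (b 1) ≠ 0 := by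
  intro h
  refine h0 (LinearMap.ext₂ fun u v ↦ ?_)
  rw [isAlt_apply_eq_of_basis b hα, h]
  simp

lemma trace_eq_of_basis (b : Module.Basis (Fin 2) ℝ W) (T : W →ₗ[ℝ] W) :
    LinearMap.trace ℝ W T = b.repr (T (b 0)) 0 + b.repr (T (b 1)) 1 := by
  rw [LinearMap.trace_eq_matrix_trace ℝ b, Matrix.trace_fin_two, LinearMap.toMatrix_apply,
    LinearMap.toMatrix_apply]

lemma apply_eq_of_basis (b : Module.Basis (Fin 2) ℝ W) (T : W →ₗ[ℝ] W) (v : W) :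
    T v = (b.repr v 0 * b.repr (T (b 0)) 0 + b.repr v 1 * b.repr (T (b 1)) 0) • b 0 +
      (b.repr v 0 * b.repr (T (b 0)) 1 + b.repr v 1 * b.repr (T (b 1)) 1) • b 1 := by
  conv_lhs => rw [← b.sum_repr v]
  simp only [Fin.sum_univ_two, map_add, map_smul]
  conv_lhs => rw [← b.sum_repr (T (b 0)), ← b.sum_repr (T (b 1))]
  simp only [Fin.sum_univ_two]
  module

lemma ext_of_basis (b : Module.Basis (Fin 2) ℝ W) {T T' : W →ₗ[ℝ] W}
    (h00 : b.repr (T (b 0)) 0 = b.repr (T' (b 0)) 0)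
    (h01 : b.repr (T (b 0)) 1 = b.repr (T' (b 0)) 1)
    (h10 : b.repr (T (b 1)) 0 = b.repr (T' (b 1)) 0)
    (h11 : b.repr (T (b 1)) 1 = b.repr (T' (b 1)) 1) : T = T' := by
  ext v
  rw [apply_eq_of_basis b T, apply_eq_of_basis b T', h00, h01, h10, h11]

/-- Two commuting trace free endomorphisms of a plane are proportional. -/
lemma exists_eq_smul_of_commute (b : Module.Basis (Fin 2) ℝ W) {S T : W →ₗ[ℝ] W}
    (hS : LinearMap.trace ℝ W S = 0) (hT : LinearMap.trace ℝ W T = 0)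
    (hST : ∀ v, S (T v) = T (S v)) (hS0 : S ≠ 0) : ∃ c : ℝ, T = c • S := by
  rw [trace_eq_of_basis b] at hS hT
  have c0 (v : W) := congrArg (fun w ↦ b.repr w 0) (hST v)
  have c1 (v : W) := congrArg (fun w ↦ b.repr w 1) (hST v)
  have e00 := c0 (b 0)
  have e01 := c1 (b 0)
  have e10 := c0 (b 1)
  rw [apply_eq_of_basis b S (T _), apply_eq_of_basis b T (S _)] at e00 e01 e10
  simp at e00 e01 e10
  set s00 := b.repr (S (b 0)) 0
  set s01 := b.repr (S (b 0)) 1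
  set s10 := b.repr (S (b 1)) 0
  set s11 := b.repr (S (b 1)) 1
  set t00 := b.repr (T (b 0)) 0
  set t01 := b.repr (T (b 0)) 1
  set t10 := b.repr (T (b 1)) 0
  set t11 := b.repr (T (b 1)) 1
  have hs : s11 = - s00 := by linarith
  have ht : t11 = - t00 := by linarith
  have key (c : ℝ) (h0 : t00 = c * s00) (h1 : t01 = c * s01) (h2 : t10 = c * s10) :
      T = c • S := by
    refine ext_of_basis b ?_ ?_ ?_ ?_ <;> simp only [LinearMap.smul_apply, map_smul,
      Finsupp.smul_apply, smul_eq_mul]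
    · exact h0
    · exact h1
    · exact h2
    · change t11 = c * s11
      rw [hs, ht, h0]; ring
  rw [hs, ht] at e01 e10
  -- For trace free matrices the commutator entries are, up to factors, the 2 × 2 minors of `(s00,
  -- s01, s10)` and `(t00, t01, t10)`; the ratio can be read off at any nonzero entry of `S`.
  by_cases h0 : s00 = 0
  · by_cases h1 : s01 = 0
    · by_cases h2 : s10 = 0
      · exfalso
        refine hS0 (ext_of_basis b ?_ ?_ ?_ ?_) <;> simp
        · exact h0
        · exact h1
        · exact h2
        · change s11 = 0
          rw [hs, h0, neg_zero]
      · refine ⟨t10 / s10, key _ ?_ ?_ ?_⟩ <;> field_simp <;> linarith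
    · refine ⟨t01 / s01, key _ ?_ ?_ ?_⟩ <;> field_simp <;> linarith
  · refine ⟨t00 / s00, key _ ?_ ?_ ?_⟩ <;> field_simp <;> linarith

variable {B : LinearMap.BilinForm ℝ W} {T T' : W →ₗ[ℝ] W}

lemma Represents.ne_zero (h : Represents B T) (hB : B ≠ 0) : T ≠ 0 := by
  rintro rfl
  obtain ⟨α, -, -, h⟩ := h
  exact hB (LinearMap.ext₂ fun u v ↦ by simp [h])

/-- The factor is absorbed by the area form, which becomes `c⁻¹ • α`. -/
lemma Represents.smul (h : Represents B T) {c : ℝ} (hc : c ≠ 0) : Represents B (c • T) := by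
  obtain ⟨α, hα, h0, h⟩ := h
  refine ⟨c⁻¹ • α, fun u ↦ by simp [hα.self_eq_zero], smul_ne_zero (inv_ne_zero hc) h0,
    fun u v ↦ ?_⟩
  simp [h, hc]

/-- Alternating forms on a plane form a line and the nonzero ones are nondegenerate, so the only
freedom in `T` is the scale of the area form. -/
lemma Represents.exists_eq_smul (b : Module.Basis (Fin 2) ℝ W)
    (h : Represents B T) (h' : Represents B T') : ∃ c : ℝ, c ≠ 0 ∧ T' = c • T := by
  obtain ⟨α, hα, h0, h⟩ := h
  obtain ⟨α', hα', h0', h'⟩ := h'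
  have k := isAlt_basis_ne_zero b hα h0
  have k' := isAlt_basis_ne_zero b hα' h0'
  refine ⟨α (b 0) (b 1) / α' (b 0) (b 1), div_ne_zero k k', ?_⟩
  have e (u v) : α (T v) u = α' (T' v) u := by rw [← h, ← h']
  have e' (u v : W) := e u v
  simp only [fun v ↦ isAlt_apply_eq_of_basis b hα (T v),
    fun v ↦ isAlt_apply_eq_of_basis b hα' (T' v)] at e'
  have e1 (v : W) := e' (b 1) v
  have e0 (v : W) := e' (b 0) v
  simp only [Module.Basis.repr_self_apply, one_ne_zero, zero_ne_one, if_true, if_false] at e1 e0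
  ext v
  refine b.ext_elem fun i ↦ ?_
  fin_cases i <;> simp <;> field_simp
  · linarith [e1 v]
  · linarith [e0 v]

/-- Symmetry of `B` says `α(T v, u) + α(v, T u) = 0`, and the left side is `tr T` times `α(v, u)`.
One pair of basis vectors suffices. -/
lemma Represents.trace_eq_zero (b : Module.Basis (Fin 2) ℝ W) (h : Represents B T)
    (hB : ∀ u v, B u v = B v u) : LinearMap.trace ℝ W T = 0 := by
  obtain ⟨α, hα, h0, h⟩ := h
  have k := isAlt_basis_ne_zero b hα h0
  have e := hB (b 0) (b 1)
  rw [h, h, isAlt_apply_eq_of_basis b hα, isAlt_apply_eq_of_basis b hα (T (b 0))] at e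
  simp only [Module.Basis.repr_self_apply, one_ne_zero, zero_ne_one, if_true, if_false] at e
  rw [trace_eq_of_basis b]
  have := mul_left_cancel₀ k e
  linarith

/-- Cayley–Hamilton: `T² = -det T` when the trace vanishes. -/
lemma apply_apply_of_trace_eq_zero (b : Module.Basis (Fin 2) ℝ W)
    (hT : LinearMap.trace ℝ W T = 0) (v : W) :
    T (T v) = (b.repr (T (b 0)) 0 ^ 2 + b.repr (T (b 0)) 1 * b.repr (T (b 1)) 0) • v := by
  rw [trace_eq_of_basis b] at hT
  have h11 : b.repr (T (b 1)) 1 = - b.repr (T (b 0)) 0 := by linarith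
  rw [apply_eq_of_basis b T (T v)]
  have e := apply_eq_of_basis b T v
  have e0 := congrArg (fun w ↦ b.repr w 0) e
  have e1 := congrArg (fun w ↦ b.repr w 1) e
  simp at e0 e1
  rw [e0, e1, h11]
  conv_rhs => rw [← b.sum_repr v]
  rw [Fin.sum_univ_two]
  module

/-- If `T` represents `B` and `T² = c`, then `det B` is a negative multiple of `c`. -/
lemma Represents.det_toMatrix (b : Module.Basis (Fin 2) ℝ W) (h : Represents B T)
    (hB : ∀ u v, B u v = B v u) {c : ℝ} (hc : ∀ v, T (T v) = c • v) :
    ∃ k : ℝ, 0 < k ∧ (LinearMap.BilinForm.toMatrix b B).det = - k * c := by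
  have htr := h.trace_eq_zero b hB
  have h2 := apply_apply_of_trace_eq_zero b htr (b 0)
  rw [hc] at h2
  have h2 := congrArg (fun w ↦ b.repr w 0) h2
  simp at h2
  rw [trace_eq_of_basis b] at htr
  have h11 : b.repr (T (b 1)) 1 = - b.repr (T (b 0)) 0 := by linarith
  obtain ⟨α, hα, h0, h⟩ := h
  have k := isAlt_basis_ne_zero b hα h0
  -- The matrix of `B` is built from that of `T` and that of `α`; the latter has determinant `α(b 0,
  -- b 1)²`, and `det T = -c`.
  refine ⟨α (b 0) (b 1) ^ 2, by positivity, ?_⟩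
  rw [Matrix.det_fin_two]
  simp only [LinearMap.BilinForm.toMatrix_apply, h]
  rw [isAlt_apply_eq_of_basis b hα (T (b 0)) (b 0), isAlt_apply_eq_of_basis b hα (T (b 0)) (b 1),
    isAlt_apply_eq_of_basis b hα (T (b 1)) (b 0), isAlt_apply_eq_of_basis b hα (T (b 1)) (b 1)]
  simp [h11, h2]
  ring

/-- A trace free endomorphism commuting with a representing one is representing. -/
lemma Represents.of_commute (b : Module.Basis (Fin 2) ℝ W) (h : Represents B T)
    (hB : ∀ u v, B u v = B v u) (hB0 : B ≠ 0) (hT' : LinearMap.trace ℝ W T' = 0)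
    (hc : ∀ v, T (T' v) = T' (T v)) (h0 : T' ≠ 0) : Represents B T' := by
  obtain ⟨c, rfl⟩ := exists_eq_smul_of_commute b (h.trace_eq_zero b hB) hT' hc (h.ne_zero hB0)
  exact h.smul fun hc ↦ h0 (by simp [hc])

/-- A nonzero form on a plane has rank one or two, and rank two means nondegenerate. -/
lemma rank_eq_one_iff_det_eq_zero (b : Module.Basis (Fin 2) ℝ W) (hB0 : B ≠ 0) :
    B.rank = 1 ↔ (LinearMap.BilinForm.toMatrix b B).det = 0 := by
  have := b.finiteDimensional_of_finite
  have hd : (LinearMap.BilinForm.toMatrix b B).det = 0 ↔ ¬ Function.Injective B := by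
    rw [← LinearMap.ker_eq_bot, ← LinearMap.BilinForm.nondegenerate_iff_ker_eq_bot,
      LinearMap.BilinForm.nondegenerate_iff_det_ne_zero b, not_not]
  have hf : Module.finrank ℝ W = 2 := by simp [Module.finrank_eq_card_basis b]
  have hr := LinearMap.finrank_range_add_finrank_ker B
  rw [hd, ← LinearMap.ker_eq_bot, ← Submodule.finrank_eq_zero]
  have h1 : B.rank = Module.finrank ℝ (LinearMap.range B) := (Module.finrank_eq_rank _ _).symm
  have h2 : Module.finrank ℝ (LinearMap.range B) ≠ 0 := by
    rw [Ne, Submodule.finrank_eq_zero, LinearMap.range_eq_bot]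
    exact hB0
  rw [h1]
  norm_cast
  omega

end LinearAlgebra

/-! ### Recurrent and parallel endomorphism fields for a connection form in coordinates. -/

section CoordinateConnection

variable {V : Type*} [NormedAddCommGroup V] [NormedSpace ℝ V]

/-- The curvature of the connection with connection form `A` in coordinates. -/
def coordCurvature (A : V → V →L[ℝ] V →L[ℝ] V) (p u v : V) : V →L[ℝ] V :=
  fderiv ℝ A p u v - fderiv ℝ A p v u + A p u * A p v - A p v * A p u

/-- In coordinates, `∇_v τ = β(v) τ` at `p`. -/
def CoordRecurrentAt (A : V → V →L[ℝ] V →L[ℝ] V) (β : V → V →L[ℝ] ℝ) (τ : V → V →L[ℝ] V)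
    (p : V) : Prop :=
  ∀ v, fderiv ℝ τ p v = β p v • τ p + τ p * A p v - A p v * τ p

/-- In coordinates, `∇τ = 0` at `p`. -/
def CoordParallelAt (A : V → V →L[ℝ] V →L[ℝ] V) (τ : V → V →L[ℝ] V) (p : V) : Prop :=
  ∀ v, fderiv ℝ τ p v = τ p * A p v - A p v * τ p

variable {A : V → V →L[ℝ] V →L[ℝ] V} {β : V → V →L[ℝ] ℝ} {τ : V → V →L[ℝ] V} {p : V}

lemma coordRecurrentAt_zero_iff : CoordRecurrentAt A 0 τ p ↔ CoordParallelAt A τ p := by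
  simp [CoordRecurrentAt, CoordParallelAt]

/-- The Ricci identity. Differentiate the recurrence equation once more, substitute it for the first
derivatives of `τ`, and use the symmetry of the second derivative: the terms `β(u) β(v) τ` cancel,
leaving the curvature commutator and `dβ`. -/
lemma coordCurvature_commutator_of_recurrent (hA : DifferentiableAt ℝ A p)
    (hβ : DifferentiableAt ℝ β p) (hτ : ContDiffAt ℝ 2 τ p)
    (h : ∀ᶠ q in 𝓝 p, CoordRecurrentAt A β τ q) (u v : V) :
    coordCurvature A p u v * τ p - τ p * coordCurvature A p u v =
      (fderiv ℝ β p u v - fderiv ℝ β p v u) • τ p := by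
  have hsymm := hτ.isSymmSndFDerivAt (by simp)
  have hdτ : DifferentiableAt ℝ τ p := hτ.differentiableAt (by simp)
  have hd : DifferentiableAt ℝ (fderiv ℝ τ) p :=
    (hτ.fderiv_right (m := 1) (by norm_num)).differentiableAt (by simp)
  have key (u v : V) : fderiv ℝ (fderiv ℝ τ) p u v =
      fderiv ℝ β p u v • τ p + β p v • fderiv ℝ τ p u
      + (fderiv ℝ τ p u * A p v + τ p * fderiv ℝ A p u v)
      - (fderiv ℝ A p u v * τ p + A p v * fderiv ℝ τ p u) := by
    have e1 : fderiv ℝ (fun q ↦ fderiv ℝ τ q v) p u = fderiv ℝ (fderiv ℝ τ) p u v := by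
      rw [fderiv_clm_apply hd (differentiableAt_const v)]
      simp
    rw [← e1]
    have e2 : (fun q ↦ fderiv ℝ τ q v) =ᶠ[𝓝 p]
        fun q ↦ β q v • τ q + τ q * A q v - A q v * τ q := by
      filter_upwards [h] with q hq using hq v
    rw [e2.fderiv_eq]
    have hAv : HasFDerivAt (fun q ↦ A q v) ((fderiv ℝ A p).flip v) p := by
      simpa using hA.hasFDerivAt.clm_apply (hasFDerivAt_const v p)
    have hβv : HasFDerivAt (fun q ↦ β q v) ((fderiv ℝ β p).flip v) p := by
      simpa using hβ.hasFDerivAt.clm_apply (hasFDerivAt_const v p)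
    have hd' : HasFDerivAt (fun q ↦ β q v • τ q + τ q * A q v - A q v * τ q) _ p :=
      ((hβv.smul hdτ.hasFDerivAt).add (hdτ.hasFDerivAt.mul' hAv)).sub (hAv.mul' hdτ.hasFDerivAt)
    rw [hd'.fderiv]
    simp
    abel
  have hs := hsymm.eq u v
  rw [key u v, key v u] at hs
  have hp := h.self_of_nhds
  rw [hp u, hp v] at hs
  rw [← sub_eq_zero] at hs ⊢
  rw [← neg_eq_zero, ← hs]
  simp only [coordCurvature, mul_sub, sub_mul, mul_add, add_mul, smul_mul_assoc, mul_smul_comm,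
    mul_assoc, sub_smul, smul_sub, smul_add]
  rw [smul_comm (β p v) (β p u)]
  abel

lemma coordCurvature_commute_of_parallel (hA : DifferentiableAt ℝ A p)
    (hτ : ContDiffAt ℝ 2 τ p) (h : ∀ᶠ q in 𝓝 p, CoordParallelAt A τ q) (u v : V) :
    coordCurvature A p u v * τ p = τ p * coordCurvature A p u v := by
  have := coordCurvature_commutator_of_recurrent (β := 0) hA (differentiableAt_const _) hτ
    (by filter_upwards [h] with q hq using coordRecurrentAt_zero_iff.2 hq) u v
  simpa [sub_eq_zero, fderiv_zero] using this

/-- A parallel endomorphism field vanishing at a point vanishes nearby. -/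
lemma CoordParallelAt.eventually_eq_zero (hA : ContinuousAt A p)
    (hτ : ∀ᶠ q in 𝓝 p, DifferentiableAt ℝ τ q) (h : ∀ᶠ q in 𝓝 p, CoordParallelAt A τ q)
    (h0 : τ p = 0) : ∀ᶠ q in 𝓝 p, τ q = 0 := by
  have hn : ContinuousAt (fun q ↦ ‖A q‖) p := hA.norm
  have hb : ∀ᶠ q in 𝓝 p, ‖A q‖ < ‖A p‖ + 1 := hn.eventually_lt_const (by linarith)
  obtain ⟨r, hr, hball⟩ := Metric.eventually_nhds_iff_ball.1 (hb.and (hτ.and h))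
  refine Metric.eventually_nhds_iff_ball.2 ⟨r, hr, fun q hq ↦ ?_⟩
  set w := q - p
  have hmem (t : ℝ) (ht : t ∈ Icc (0 : ℝ) 1) : p + t • w ∈ Metric.ball p r := by
    have := (convex_ball p r).add_smul_sub_mem (Metric.mem_ball_self hr) hq ht
    simpa using this
  have hder (t : ℝ) (ht : t ∈ Icc (0 : ℝ) 1) :
      HasDerivAt (fun s : ℝ ↦ τ (p + s • w)) (fderiv ℝ τ (p + t • w) w) t := by
    have h1 : HasDerivAt (fun s : ℝ ↦ p + s • w) w t := by
      simpa using ((hasDerivAt_id t).smul_const w).const_add p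
    exact (hball _ (hmem t ht)).2.1.hasFDerivAt.comp_hasDerivAt t h1
  -- Grönwall on the segment from `p` to `q`: there `τ` solves the linear equation `τ' = [τ, A w]`,
  -- and the commutator costs the factor `2` in `K`.
  have hz := eq_zero_of_abs_deriv_le_mul_abs_self_of_eq_zero_right
    (f := fun s : ℝ ↦ τ (p + s • w)) (f' := fun t ↦ fderiv ℝ τ (p + t • w) w)
    (K := 2 * ((‖A p‖ + 1) * ‖w‖)) (a := 0) (b := 1)
    (fun t ht ↦ (hder t ht).continuousAt.continuousWithinAt)
    (fun t ht ↦ (hder t (Ico_subset_Icc_self ht)).hasDerivWithinAt) (by simpa using h0) ?_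
    1 (by simp)
  · simpa [w] using hz
  · intro t ht
    have hm := hball _ (hmem t (Ico_subset_Icc_self ht))
    rw [hm.2.2 w]
    set q' := p + t • w
    have hAw : ‖A q' w‖ ≤ (‖A p‖ + 1) * ‖w‖ :=
      (A q').le_of_opNorm_le hm.1.le w
    calc ‖τ q' * A q' w - A q' w * τ q'‖
        ≤ ‖τ q' * A q' w‖ + ‖A q' w * τ q'‖ := norm_sub_le _ _
      _ ≤ ‖τ q'‖ * ‖A q' w‖ + ‖A q' w‖ * ‖τ q'‖ := add_le_add (norm_mul_le _ _) (norm_mul_le _ _)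
      _ = 2 * ‖A q' w‖ * ‖τ q'‖ := by ring
      _ ≤ 2 * ((‖A p‖ + 1) * ‖w‖) * ‖τ q'‖ := by gcongr

/-- A nonvanishing recurrent endomorphism field commuting with the curvature can be rescaled to a
parallel one. -/
lemma exists_contDiffOn_smul_parallel {U : Set V} (hU : IsOpen U) (hUc : Convex ℝ U)
    (hA : DifferentiableOn ℝ A U) (hβ : ContDiffOn ℝ ∞ β U) (hτ : ContDiffOn ℝ ∞ τ U)
    (h : ∀ q ∈ U, CoordRecurrentAt A β τ q) (h0 : ∀ q ∈ U, τ q ≠ 0)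
    (hc : ∀ q ∈ U, ∀ u v, coordCurvature A q u v * τ q = τ q * coordCurvature A q u v) :
    ∃ g : V → ℝ, (∀ q, g q ≠ 0) ∧ ContDiffOn ℝ ∞ (fun q ↦ g q • τ q) U ∧
      ∀ q ∈ U, CoordParallelAt A (fun q ↦ g q • τ q) q := by
  have hβd : DifferentiableOn ℝ β U := hβ.differentiableOn (by simp)
  -- Poincaré lemma: by the Ricci identity `dβ(u, v) τ` is the commutator of the curvature with `τ`,
  -- which vanishes, and `τ ≠ 0`; hence `β` is closed, and `β = df`.
  obtain ⟨f, hf⟩ := hUc.exists_forall_hasFDerivAt_of_fderiv_symmetric hU hβd (by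
    intro q hq u v
    have hn := hU.mem_nhds hq
    have := coordCurvature_commutator_of_recurrent (hA.differentiableAt hn)
      (hβd.differentiableAt hn) ((hτ.contDiffAt hn).of_le (by norm_cast))
      (by filter_upwards [hn] with y hy using h y hy) u v
    rw [hc q hq, sub_self, eq_comm, smul_eq_zero, sub_eq_zero] at this
    exact this.resolve_right (h0 q hq))
  have hfs : ContDiffOn ℝ ∞ f U := by
    rw [contDiffOn_infty_iff_fderiv_of_isOpen hU]
    exact ⟨fun q hq ↦ (hf q hq).differentiableAt.differentiableWithinAt,
      hβ.congr fun q hq ↦ (hf q hq).fderiv⟩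
  -- The derivative of the factor contributes `-df = -β`, which cancels the recurrence form.
  refine ⟨fun q ↦ Real.exp (-f q), fun q ↦ (Real.exp_pos _).ne', hfs.neg.exp.smul hτ, ?_⟩
  intro q hq v
  have hn := hU.mem_nhds hq
  have h1 : HasFDerivAt (fun q ↦ Real.exp (-f q) • τ q) _ q := ((hf q hq).neg.exp).smul
    ((hτ.contDiffAt hn).differentiableAt (by simp)).hasFDerivAt
  rw [h1.fderiv]
  simp [h q hq v]
  module

end CoordinateConnection

/-! ### Tangent vectors, tensor fields and coordinate frames in a chart. -/

section Chart

/-- The model space of `n`-dimensional manifolds. -/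
abbrev Model (n : ℕ) := EuclideanSpace ℝ (Fin n)

variable {n : ℕ} {M : Type*} [TopologicalSpace M] [ChartedSpace (Model n) M] {x₀ y : M}

lemma source_mem_nhds (hy : y ∈ (chartAt (Model n) x₀).source) :
    (chartAt (Model n) x₀).source ∈ 𝓝 y :=
  (chartAt (Model n) x₀).open_source.mem_nhds hy

variable (x₀) in
lemma isOpen_target : IsOpen (extChartAt (𝓡 n) x₀).target := isOpen_extChartAt_target x₀

lemma extChartAt_mem_target (hy : y ∈ (chartAt (Model n) x₀).source) :
    extChartAt (𝓡 n) x₀ y ∈ (extChartAt (𝓡 n) x₀).target :=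
  (extChartAt (𝓡 n) x₀).map_source (by simpa using hy)

lemma extChartAt_symm_mem_source {p : Model n} (hp : p ∈ (extChartAt (𝓡 n) x₀).target) :
    (extChartAt (𝓡 n) x₀).symm p ∈ (chartAt (Model n) x₀).source := by
  simpa using (extChartAt (𝓡 n) x₀).map_target hp

lemma symm_extChartAt (hy : y ∈ (chartAt (Model n) x₀).source) :
    (extChartAt (𝓡 n) x₀).symm (extChartAt (𝓡 n) x₀ y) = y :=
  (extChartAt (𝓡 n) x₀).left_inv (by simpa using hy)

lemma tendsto_extChartAt (hy : y ∈ (chartAt (Model n) x₀).source) :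
    Tendsto (extChartAt (𝓡 n) x₀) (𝓝 y) (𝓝 (extChartAt (𝓡 n) x₀ y)) :=
  continuousAt_extChartAt' (by simpa using hy)

lemma tendsto_extChartAt_symm (hy : y ∈ (chartAt (Model n) x₀).source) :
    Tendsto (extChartAt (𝓡 n) x₀).symm (𝓝 (extChartAt (𝓡 n) x₀ y)) (𝓝 y) := by
  have := continuousAt_extChartAt_symm'' (I := 𝓡 n) (extChartAt_mem_target hy)
  rwa [ContinuousAt, symm_extChartAt hy] at this

variable [IsManifold (𝓡 n) ∞ M]

/-- Coordinates of tangent vectors at `y` in the chart at `x₀`. -/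
def toCoord (x₀ y : M) : TangentSpace (𝓡 n) y →L[ℝ] Model n :=
  (trivializationAt (Model n) (TangentSpace (𝓡 n)) x₀).continuousLinearMapAt ℝ y

/-- The tangent vector at `y` with given coordinates in the chart at `x₀`. -/
def ofCoord (x₀ y : M) : Model n →L[ℝ] TangentSpace (𝓡 n) y :=
  (trivializationAt (Model n) (TangentSpace (𝓡 n)) x₀).symmL ℝ y

lemma mem_baseSet (hy : y ∈ (chartAt (Model n) x₀).source) :
    y ∈ (trivializationAt (Model n) (TangentSpace (𝓡 n)) x₀).baseSet := by
  simpa using hy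

lemma toCoord_ofCoord (hy : y ∈ (chartAt (Model n) x₀).source) (v : Model n) :
    toCoord x₀ y (ofCoord x₀ y v) = v :=
  (trivializationAt (Model n) (TangentSpace (𝓡 n)) x₀).continuousLinearMapAt_symmL (R := ℝ)
    (mem_baseSet hy) v

lemma ofCoord_toCoord (hy : y ∈ (chartAt (Model n) x₀).source) (v : TangentSpace (𝓡 n) y) :
    ofCoord x₀ y (toCoord x₀ y v) = v :=
  (trivializationAt (Model n) (TangentSpace (𝓡 n)) x₀).symmL_continuousLinearMapAt (R := ℝ)
    (mem_baseSet hy) v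

lemma trivializationAt_snd_eq_toCoord (hy : y ∈ (chartAt (Model n) x₀).source)
    (v : TangentSpace (𝓡 n) y) :
    (trivializationAt (Model n) (TangentSpace (𝓡 n)) x₀ ⟨y, v⟩).2 = toCoord x₀ y v := by
  rw [toCoord, Trivialization.continuousLinearMapAt_apply,
    Trivialization.coe_linearMapAt_of_mem _ (mem_baseSet hy)]

variable {F : Type*} [NormedAddCommGroup F] [NormedSpace ℝ F]

lemma contDiffAt_congr_iff {V : Type*} [NormedAddCommGroup V] [NormedSpace ℝ V] {f g : V → F}
    {p : V} (h : f =ᶠ[𝓝 p] g) : ContDiffAt ℝ ∞ f p ↔ ContDiffAt ℝ ∞ g p :=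
  ⟨fun hf ↦ hf.congr_of_eventuallyEq h.symm, fun hg ↦ hg.congr_of_eventuallyEq h⟩

lemma contMDiffAt_iff_comp_symm (hy : y ∈ (chartAt (Model n) x₀).source) {f : M → F} :
    ContMDiffAt (𝓡 n) 𝓘(ℝ, F) ∞ f y ↔
      ContDiffAt ℝ ∞ (f ∘ (extChartAt (𝓡 n) x₀).symm) (extChartAt (𝓡 n) x₀ y) := by
  rw [contMDiffAt_iff_source_of_mem_source (x := x₀) hy]
  simp [contMDiffAt_iff_contDiffAt, contMDiffWithinAt_univ]

lemma mdifferentiableAt_iff_comp_symm (hy : y ∈ (chartAt (Model n) x₀).source) {f : M → F} :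
    MDifferentiableAt (𝓡 n) 𝓘(ℝ, F) f y ↔
      DifferentiableAt ℝ (f ∘ (extChartAt (𝓡 n) x₀).symm) (extChartAt (𝓡 n) x₀ y) := by
  have : IsManifold (𝓡 n) 1 M := .of_le (n := ∞) (by simp)
  rw [mdifferentiableAt_iff_source_of_mem_source (x := x₀) hy]
  simp [mdifferentiableAt_iff_differentiableAt, mdifferentiableWithinAt_univ]

lemma toCoord_eq_mfderiv (hy : y ∈ (chartAt (Model n) x₀).source) :
    toCoord x₀ y = mfderiv (𝓡 n) 𝓘(ℝ, Model n) (extChartAt (𝓡 n) x₀) y :=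
  TangentBundle.continuousLinearMapAt_trivializationAt hy

lemma mvfderiv_eq_fderiv_comp_symm (hy : y ∈ (chartAt (Model n) x₀).source) {f : M → F}
    (hf : MDifferentiableAt (𝓡 n) 𝓘(ℝ, F) f y) (v : TangentSpace (𝓡 n) y) :
    mvfderiv (𝓡 n) f y v =
      fderiv ℝ (f ∘ (extChartAt (𝓡 n) x₀).symm) (extChartAt (𝓡 n) x₀ y) (toCoord x₀ y v) := by
  have : IsManifold (𝓡 n) 1 M := .of_le (n := ∞) (by simp)
  have hd := (mdifferentiableAt_iff_comp_symm hy).1 hf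
  have he : f =ᶠ[𝓝 y] (f ∘ (extChartAt (𝓡 n) x₀).symm) ∘ extChartAt (𝓡 n) x₀ := by
    filter_upwards [source_mem_nhds hy] with z hz
    simp only [Function.comp_apply, symm_extChartAt hz]
  rw [mvfderiv, ContinuousLinearMap.comp_apply, he.mfderiv_eq,
    mfderiv_comp y hd.mdifferentiableAt (mdifferentiableAt_extChartAt hy),
    mfderiv_eq_fderiv, toCoord_eq_mfderiv hy]
  rfl

/-- A vector field in the chart at `x₀`. -/
def coordField (x₀ : M) (Z : Π x : M, TangentSpace (𝓡 n) x) (p : Model n) : Model n :=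
  toCoord x₀ ((extChartAt (𝓡 n) x₀).symm p) (Z ((extChartAt (𝓡 n) x₀).symm p))

/-- An endomorphism field in the chart at `x₀`. -/
def coordEnd (x₀ : M) (T : Π x : M, TangentSpace (𝓡 n) x →L[ℝ] TangentSpace (𝓡 n) x)
    (p : Model n) : Model n →L[ℝ] Model n :=
  toCoord x₀ ((extChartAt (𝓡 n) x₀).symm p) ∘L T ((extChartAt (𝓡 n) x₀).symm p) ∘L
    ofCoord x₀ ((extChartAt (𝓡 n) x₀).symm p)

/-- A 1-form in the chart at `x₀`. -/
def coordForm (x₀ : M) (η : Π x : M, TangentSpace (𝓡 n) x →L[ℝ] ℝ) (p : Model n) :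
    Model n →L[ℝ] ℝ :=
  η ((extChartAt (𝓡 n) x₀).symm p) ∘L ofCoord x₀ ((extChartAt (𝓡 n) x₀).symm p)

lemma coordField_extChartAt (hy : y ∈ (chartAt (Model n) x₀).source)
    (Z : Π x : M, TangentSpace (𝓡 n) x) :
    coordField x₀ Z (extChartAt (𝓡 n) x₀ y) = toCoord x₀ y (Z y) := by
  rw [coordField, symm_extChartAt hy]

lemma coordEnd_extChartAt (hy : y ∈ (chartAt (Model n) x₀).source)
    (T : Π x : M, TangentSpace (𝓡 n) x →L[ℝ] TangentSpace (𝓡 n) x) (v : Model n) :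
    coordEnd x₀ T (extChartAt (𝓡 n) x₀ y) v = toCoord x₀ y (T y (ofCoord x₀ y v)) := by
  rw [coordEnd, symm_extChartAt hy]
  rfl

lemma coordForm_extChartAt (hy : y ∈ (chartAt (Model n) x₀).source)
    (η : Π x : M, TangentSpace (𝓡 n) x →L[ℝ] ℝ) (v : Model n) :
    coordForm x₀ η (extChartAt (𝓡 n) x₀ y) v = η y (ofCoord x₀ y v) := by
  rw [coordForm, symm_extChartAt hy]
  rfl

lemma mdifferentiableAt_iff_coordField (hy : y ∈ (chartAt (Model n) x₀).source)
    {Z : Π x : M, TangentSpace (𝓡 n) x} :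
    MDifferentiableAt (𝓡 n) ((𝓡 n).prod 𝓘(ℝ, Model n))
        (fun x ↦ (TotalSpace.mk' (Model n) x (Z x) : TangentBundle (𝓡 n) M)) y ↔
      DifferentiableAt ℝ (coordField x₀ Z) (extChartAt (𝓡 n) x₀ y) := by
  rw [(trivializationAt (Model n) (TangentSpace (𝓡 n)) x₀).mdifferentiableAt_section_iff (𝓡 n) Z
    (mem_baseSet hy), mdifferentiableAt_iff_comp_symm hy]
  refine Filter.EventuallyEq.differentiableAt_iff ?_
  filter_upwards [(isOpen_target x₀).mem_nhds (extChartAt_mem_target hy)] with p hp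
  exact trivializationAt_snd_eq_toCoord (extChartAt_symm_mem_source hp) _

lemma contMDiffAt_iff_coordField (hy : y ∈ (chartAt (Model n) x₀).source)
    {Z : Π x : M, TangentSpace (𝓡 n) x} :
    ContMDiffAt (𝓡 n) ((𝓡 n).prod 𝓘(ℝ, Model n)) ∞
        (fun x ↦ (TotalSpace.mk' (Model n) x (Z x) : TangentBundle (𝓡 n) M)) y ↔
      ContDiffAt ℝ ∞ (coordField x₀ Z) (extChartAt (𝓡 n) x₀ y) := by
  rw [(trivializationAt (Model n) (TangentSpace (𝓡 n)) x₀).contMDiffAt_section_iff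
    (mem_baseSet hy), contMDiffAt_iff_comp_symm hy]
  refine contDiffAt_congr_iff ?_
  filter_upwards [(isOpen_target x₀).mem_nhds (extChartAt_mem_target hy)] with p hp
  exact trivializationAt_snd_eq_toCoord (extChartAt_symm_mem_source hp) _

lemma contMDiffAt_iff_coordEnd (hy : y ∈ (chartAt (Model n) x₀).source)
    {T : Π x : M, TangentSpace (𝓡 n) x →L[ℝ] TangentSpace (𝓡 n) x} :
    ContMDiffAt (𝓡 n) ((𝓡 n).prod 𝓘(ℝ, Model n →L[ℝ] Model n)) ∞
        (fun x ↦ TotalSpace.mk' (Model n →L[ℝ] Model n)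
          (E := fun x : M ↦ TangentSpace (𝓡 n) x →L[ℝ] TangentSpace (𝓡 n) x) x (T x)) y ↔
      ContDiffAt ℝ ∞ (coordEnd x₀ T) (extChartAt (𝓡 n) x₀ y) := by
  rw [(trivializationAt (Model n →L[ℝ] Model n)
    (fun x : M ↦ TangentSpace (𝓡 n) x →L[ℝ] TangentSpace (𝓡 n) x) x₀).contMDiffAt_section_iff
    ⟨mem_baseSet hy, mem_baseSet hy⟩, contMDiffAt_iff_comp_symm hy]
  rfl

lemma contMDiffAt_iff_coordForm (hy : y ∈ (chartAt (Model n) x₀).source)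
    {η : Π x : M, TangentSpace (𝓡 n) x →L[ℝ] ℝ} :
    ContMDiffAt (𝓡 n) ((𝓡 n).prod 𝓘(ℝ, Model n →L[ℝ] ℝ)) ∞
        (fun x ↦ TotalSpace.mk' (Model n →L[ℝ] ℝ)
          (E := fun x : M ↦ TangentSpace (𝓡 n) x →L[ℝ] ℝ) x (η x)) y ↔
      ContDiffAt ℝ ∞ (coordForm x₀ η) (extChartAt (𝓡 n) x₀ y) := by
  rw [(trivializationAt (Model n →L[ℝ] ℝ)
    (fun x : M ↦ TangentSpace (𝓡 n) x →L[ℝ] ℝ) x₀).contMDiffAt_section_iff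
    ⟨mem_baseSet hy, mem_univ _⟩, contMDiffAt_iff_comp_symm hy]
  refine contDiffAt_congr_iff ?_
  filter_upwards with p
  ext v
  change ContinuousLinearMap.inCoordinates (Model n) (TangentSpace (𝓡 n)) ℝ (Trivial M ℝ) x₀
    ((extChartAt (𝓡 n) x₀).symm p) x₀ ((extChartAt (𝓡 n) x₀).symm p)
    (η ((extChartAt (𝓡 n) x₀).symm p)) v = _
  rw [ContinuousLinearMap.inCoordinates]
  -- The cotangent bundle is a bundle of homomorphisms into a trivial line bundle, whose
  -- trivialization is the identity.
  erw [Bundle.Trivial.continuousLinearMapAt_trivialization]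
  rfl

/-- The vector field with constant coefficients `v` in the chart at `x₀`. -/
def frame (x₀ : M) (v : Model n) (y : M) : TangentSpace (𝓡 n) y := ofCoord x₀ y v

lemma coordField_frame (v : Model n) {p : Model n} (hp : p ∈ (extChartAt (𝓡 n) x₀).target) :
    coordField x₀ (frame x₀ v) p = v :=
  toCoord_ofCoord (extChartAt_symm_mem_source hp) v

lemma contMDiffAt_frame (hy : y ∈ (chartAt (Model n) x₀).source) (v : Model n) :
    ContMDiffAt (𝓡 n) ((𝓡 n).prod 𝓘(ℝ, Model n)) ∞
        (fun x ↦ (TotalSpace.mk' (Model n) x (frame x₀ v x) : TangentBundle (𝓡 n) M)) y := by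
  rw [contMDiffAt_iff_coordField hy]
  refine (contDiffAt_const (c := v)).congr_of_eventuallyEq ?_
  filter_upwards [(isOpen_target x₀).mem_nhds (extChartAt_mem_target hy)] with p hp
  exact coordField_frame v hp

lemma mdifferentiableAt_frame (hy : y ∈ (chartAt (Model n) x₀).source) (v : Model n) :
    MDifferentiableAt (𝓡 n) ((𝓡 n).prod 𝓘(ℝ, Model n))
        (fun x ↦ (TotalSpace.mk' (Model n) x (frame x₀ v x) : TangentBundle (𝓡 n) M)) y :=
  (contMDiffAt_frame hy v).mdifferentiableAt (by simp)

/-- Coordinate fields are pullbacks of constant fields under the chart, and brackets commute with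
pullback. -/
lemma mlieBracket_frame (hy : y ∈ (chartAt (Model n) x₀).source) (u v : Model n) :
    mlieBracket (𝓡 n) (frame x₀ u) (frame x₀ v) y = 0 := by
  have : IsManifold (𝓡 n) 1 M := .of_le (n := ∞) (by simp)
  have : IsManifold (𝓡 n) (minSmoothness ℝ 3) M := .of_le (n := ∞) (by simp; norm_cast)
  have he (w : Model n) : frame x₀ w =ᶠ[𝓝 y]
      mpullback (𝓡 n) 𝓘(ℝ, Model n) (extChartAt (𝓡 n) x₀) (fun _ ↦ w) := by
    filter_upwards [source_mem_nhds hy] with z hz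
    have hz' : z ∈ (extChartAt (𝓡 n) x₀).source := by simpa using hz
    refine (((isInvertible_mfderiv_extChartAt hz').inverse_apply_eq).2 ?_).symm
    rw [← toCoord_eq_mfderiv hz]
    exact (toCoord_ofCoord hz w).symm
  have hc (w : Model n) : MDifferentiableAt 𝓘(ℝ, Model n) (𝓘(ℝ, Model n).prod 𝓘(ℝ, Model n))
      (fun x ↦ (TotalSpace.mk' (Model n) x w : TangentBundle 𝓘(ℝ, Model n) (Model n)))
      (extChartAt (𝓡 n) x₀ y) :=
    ((contMDiffAt_vectorSpace_iff_contDiffAt (n := 1)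
      (V := fun _ ↦ w)).2 contDiffAt_const).mdifferentiableAt (by simp)
  have hy' : y ∈ (extChartAt (𝓡 n) x₀).source := by simpa using hy
  rw [(he u).mlieBracket_vectorField_eq (he v), ← mpullback_mlieBracket (n := ∞) (hc u) (hc v)
    (contMDiffAt_extChartAt' hy) (by simp; norm_cast)]
  have hl (p : Model n) : lieBracketWithin ℝ (fun _ : Model n ↦ u) (fun _ : Model n ↦ v) univ p
      = 0 := by
    simp [lieBracketWithin]
  have hb (p : Model n) : mlieBracket 𝓘(ℝ, Model n) (fun _ ↦ u) (fun _ ↦ v) p = 0 := by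
    have h (U V : Π x, TangentSpace 𝓘(ℝ, Model n) x) :
        mlieBracket 𝓘(ℝ, Model n) U V p = lieBracketWithin ℝ U V univ p := by
      rw [← mlieBracketWithin_univ, mlieBracketWithin_eq_lieBracketWithin]
    exact (h _ _).trans (hl p)
  exact (congrArg _ (hb _)).trans (map_zero _)

end Chart

/-! ### The connection and its curvature in a chart. -/

section Connection

variable {n : ℕ} {M : Type*} [TopologicalSpace M] [ChartedSpace (Model n) M]
  [IsManifold (𝓡 n) ∞ M] {x₀ y : M}

/-- The coordinates of a section, as functions on `M`, with respect to the frame at `x₀`. -/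
lemma eventually_eq_sum_smul_frame (hy : y ∈ (chartAt (Model n) x₀).source)
    (Z : Π x : M, TangentSpace (𝓡 n) x) :
    ∀ᶠ x in 𝓝 y, Z x = ∑ i, coordField x₀ Z (extChartAt (𝓡 n) x₀ x) i •
      frame x₀ (EuclideanSpace.single i 1) x := by
  filter_upwards [source_mem_nhds hy] with x hx
  conv_lhs => rw [← ofCoord_toCoord hx (Z x)]
  rw [coordField_extChartAt hx]
  simp only [frame, ← map_smul, ← map_sum]
  congr 1
  ext j
  simp [Finset.sum_apply, Pi.single_apply]

variable [T2Space M]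

/-- Cutting off with a bump function. Parallelism and recurrence are tested on global smooth fields,
while coordinate frames exist only locally. -/
lemma exists_smoothVectorField_eventuallyEq {x : M} {Z : Π x : M, TangentSpace (𝓡 n) x}
    {u : Set M} (hu : u ∈ 𝓝 x)
    (hZ : ContMDiffOn (𝓡 n) ((𝓡 n).prod 𝓘(ℝ, Model n)) ∞
      (fun x ↦ (TotalSpace.mk' (Model n) x (Z x) : TangentBundle (𝓡 n) M)) u) :
    ∃ Y : Π x : M, TangentSpace (𝓡 n) x, SmoothVectorField Y ∧ ∀ᶠ y in 𝓝 x, Y y = Z y := by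
  obtain ⟨v, hvu, hvo, hxv⟩ := mem_nhds_iff.mp hu
  obtain ⟨f, -, hf⟩ := (SmoothBumpFunction.nhds_basis_tsupport (I := 𝓡 n) x).mem_iff.mp
    (hvo.mem_nhds hxv)
  refine ⟨(f : M → ℝ) • Z,
    ContMDiffOn.smul_section_of_tsupport (f.contMDiff.contMDiffOn (s := v)) hvo hf
      (hZ.mono hvu), ?_⟩
  filter_upwards [f.eventuallyEq_one] with z hz
  simp [hz]

lemma exists_smoothVectorField_eventuallyEq_frame (hy : y ∈ (chartAt (Model n) x₀).source)
    (v : Model n) :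
    ∃ Y : Π x : M, TangentSpace (𝓡 n) x, SmoothVectorField Y ∧ ∀ᶠ x in 𝓝 y, Y x = frame x₀ v x :=
  exists_smoothVectorField_eventuallyEq (source_mem_nhds hy)
    fun _ hx ↦ (contMDiffAt_frame hx v).contMDiffWithinAt

variable (cov : CovariantDerivative (𝓡 n) (Model n) (TangentSpace (𝓡 n) : M → Type _))

omit [T2Space M] in
lemma cov_congr {Z Z' : Π x : M, TangentSpace (𝓡 n) x}
    (hZ : MDifferentiableAt (𝓡 n) ((𝓡 n).prod 𝓘(ℝ, Model n))
      (fun x ↦ (TotalSpace.mk' (Model n) x (Z x) : TangentBundle (𝓡 n) M)) y)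
    (h : ∀ᶠ x in 𝓝 y, Z x = Z' x) : cov Z y = cov Z' y := by
  refine cov.isCovariantDerivativeOnUniv.congr_of_eventuallyEq hZ (hZ.congr_of_eventuallyEq ?_)
    univ_mem h
  filter_upwards [h] with x hx
  rw [hx]

omit [T2Space M] in
lemma cov_sum {ι : Type*} (s : Finset ι) (Z : ι → Π x : M, TangentSpace (𝓡 n) x)
    (hZ : ∀ i, MDifferentiableAt (𝓡 n) ((𝓡 n).prod 𝓘(ℝ, Model n))
      (fun x ↦ (TotalSpace.mk' (Model n) x (Z i x) : TangentBundle (𝓡 n) M)) y) :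
    cov (fun x ↦ ∑ i ∈ s, Z i x) y = ∑ i ∈ s, cov (Z i) y := by
  classical
  induction s using Finset.induction_on with
  | empty => exact cov.isCovariantDerivativeOnUniv.zero (x := y)
  | insert i s hi ih =>
    simp only [Finset.sum_insert hi]
    rw [← ih]
    exact cov.isCovariantDerivativeOnUniv.add (hZ i)
      (MDifferentiableAt.sum_section fun i _ ↦ hZ i)

/-- The connection form of `cov` in the chart at `x₀`. -/
def christoffel (x₀ : M) (p : Model n) : Model n →L[ℝ] Model n →L[ℝ] Model n :=
  ∑ i, (ContinuousLinearMap.smulRightL ℝ (Model n) (Model n) (EuclideanSpace.proj i)) ∘L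
    coordEnd x₀ (cov (frame x₀ (EuclideanSpace.single i 1))) p

omit [T2Space M] in
lemma christoffel_apply (p v w : Model n) :
    christoffel cov x₀ p v w =
      ∑ i, w i • coordEnd x₀ (cov (frame x₀ (EuclideanSpace.single i 1))) p v := by
  simp [christoffel]

omit [T2Space M] in
/-- The covariant derivative in coordinates. -/
lemma toCoord_cov (hy : y ∈ (chartAt (Model n) x₀).source) {Z : Π x : M, TangentSpace (𝓡 n) x}
    (hZ : MDifferentiableAt (𝓡 n) ((𝓡 n).prod 𝓘(ℝ, Model n))
      (fun x ↦ (TotalSpace.mk' (Model n) x (Z x) : TangentBundle (𝓡 n) M)) y)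
    (v : TangentSpace (𝓡 n) y) :
    toCoord x₀ y (cov Z y v) =
      fderiv ℝ (coordField x₀ Z) (extChartAt (𝓡 n) x₀ y) (toCoord x₀ y v) +
      christoffel cov x₀ (extChartAt (𝓡 n) x₀ y) (toCoord x₀ y v)
        (coordField x₀ Z (extChartAt (𝓡 n) x₀ y)) := by
  have hz := (mdifferentiableAt_iff_coordField hy).1 hZ
  set z := coordField x₀ Z
  set f : Fin n → M → ℝ := fun i x ↦ z (extChartAt (𝓡 n) x₀ x) i
  have hfe (i) : f i ∘ (extChartAt (𝓡 n) x₀).symm =ᶠ[𝓝 (extChartAt (𝓡 n) x₀ y)] fun p ↦ z p i := by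
    filter_upwards [(isOpen_target x₀).mem_nhds (extChartAt_mem_target hy)] with p hp
    simp only [f, Function.comp_apply, (extChartAt (𝓡 n) x₀).right_inv hp]
  have hzi (i) : HasFDerivAt (fun p ↦ z p i)
      ((EuclideanSpace.proj i : Model n →L[ℝ] ℝ) ∘L fderiv ℝ z (extChartAt (𝓡 n) x₀ y))
      (extChartAt (𝓡 n) x₀ y) :=
    (EuclideanSpace.proj i : Model n →L[ℝ] ℝ).hasFDerivAt.comp _ hz.hasFDerivAt
  have hf (i) : MDifferentiableAt (𝓡 n) 𝓘(ℝ, ℝ) (f i) y := by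
    rw [mdifferentiableAt_iff_comp_symm hy, (hfe i).differentiableAt_iff]
    exact (hzi i).differentiableAt
  have hdf (i) : mvfderiv (𝓡 n) (f i) y v =
      fderiv ℝ z (extChartAt (𝓡 n) x₀ y) (toCoord x₀ y v) i := by
    rw [mvfderiv_eq_fderiv_comp_symm hy (hf i), (hfe i).fderiv_eq, (hzi i).fderiv]
    simp
  have hfr (i : Fin n) := mdifferentiableAt_frame hy (EuclideanSpace.single i (1 : ℝ))
  rw [cov_congr cov hZ (eventually_eq_sum_smul_frame hy Z),
    cov_sum cov _ (fun i x ↦ f i x • frame x₀ (EuclideanSpace.single i 1) x)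
      fun i ↦ (hf i).smul_section (hfr i)]
  have hl (i) : cov (fun x ↦ f i x • frame x₀ (EuclideanSpace.single i 1) x) y =
      f i y • cov (frame x₀ (EuclideanSpace.single i 1)) y +
        (mvfderiv (𝓡 n) (f i) y).smulRight (frame x₀ (EuclideanSpace.single i 1) y) :=
    cov.isCovariantDerivativeOnUniv.leibniz (hfr i) (hf i)
  rw [Finset.sum_congr rfl fun i _ ↦ hl i]
  simp only [sum_apply, add_apply, smul_apply,
    ContinuousLinearMap.smulRight_apply, hdf, map_sum, map_add, map_smul, Finset.sum_add_distrib,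
    christoffel_apply, coordEnd_extChartAt hy, ofCoord_toCoord hy, frame, toCoord_ofCoord hy]
  rw [add_comm]
  congr 1
  ext j
  simp [Finset.sum_apply, Pi.single_apply]

section Smooth

variable [hcov : cov.ContMDiffCovariantDerivative ∞]

lemma contMDiffAt_cov {x : M} {Z : Π x : M, TangentSpace (𝓡 n) x} {u : Set M} (hu : u ∈ 𝓝 x)
    (hZ : ContMDiffOn (𝓡 n) ((𝓡 n).prod 𝓘(ℝ, Model n)) ∞
      (fun x ↦ (TotalSpace.mk' (Model n) x (Z x) : TangentBundle (𝓡 n) M)) u) :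
    ContMDiffAt (𝓡 n) ((𝓡 n).prod 𝓘(ℝ, Model n →L[ℝ] Model n)) ∞
      (fun y ↦ TotalSpace.mk' (Model n →L[ℝ] Model n)
        (E := fun y : M ↦ TangentSpace (𝓡 n) y →L[ℝ] TangentSpace (𝓡 n) y) y (cov Z y)) x := by
  obtain ⟨Y, hY, hYZ⟩ := exists_smoothVectorField_eventuallyEq hu hZ
  have hc := hcov.contMDiff.contMDiff (σ := Y) (ContMDiff.contMDiffOn hY)
  refine (hc.contMDiffAt univ_mem).congr_of_eventuallyEq ?_
  filter_upwards [hYZ.eventually_nhds] with y hy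
  rw [cov_congr cov ((hY y).mdifferentiableAt (by simp)) hy]

variable (x₀) in
lemma contDiffOn_christoffel :
    ContDiffOn ℝ ∞ (christoffel cov x₀) (extChartAt (𝓡 n) x₀).target := by
  intro p hp
  have hs := extChartAt_symm_mem_source hp
  have h (i : Fin n) : ContDiffAt ℝ ∞
      (coordEnd x₀ (cov (frame x₀ (EuclideanSpace.single i 1)))) p := by
    have h1 := (contMDiffAt_iff_coordEnd hs).1 (contMDiffAt_cov cov (source_mem_nhds hs)
      fun _ hx ↦ (contMDiffAt_frame hx (EuclideanSpace.single i 1)).contMDiffWithinAt)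
    rwa [(extChartAt (𝓡 n) x₀).right_inv hp] at h1
  exact (ContDiffAt.sum fun i _ ↦ contDiffAt_const.clm_comp (h i)).contDiffWithinAt

lemma contDiffAt_christoffel (hy : y ∈ (chartAt (Model n) x₀).source) :
    ContDiffAt ℝ ∞ (christoffel cov x₀) (extChartAt (𝓡 n) x₀ y) :=
  (contDiffOn_christoffel x₀ cov).contDiffAt
    ((isOpen_target x₀).mem_nhds (extChartAt_mem_target hy))

/-- The curvature in coordinates. -/
lemma toCoord_curvature (hy : y ∈ (chartAt (Model n) x₀).source) (u v w : TangentSpace (𝓡 n) y) :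
    toCoord x₀ y (curvature cov y w u v) =
      coordCurvature (christoffel cov x₀) (extChartAt (𝓡 n) x₀ y) (toCoord x₀ y u)
        (toCoord x₀ y v) (toCoord x₀ y w) := by
  obtain ⟨s, hs, hsm⟩ := exists_contMDiffOn_extend (k := ∞) (𝓡 n) (Model n) w
  have hwy : extend (Model n) w y = w := by simp
  set Z : Π x : M, TangentSpace (𝓡 n) x := extend (Model n) w
  set z := coordField x₀ Z
  set A := christoffel cov x₀
  set p := extChartAt (𝓡 n) x₀ y
  have hZ : ∀ᶠ x in 𝓝 y, ContMDiffAt (𝓡 n) ((𝓡 n).prod 𝓘(ℝ, Model n)) ∞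
      (fun x ↦ (TotalSpace.mk' (Model n) x (Z x) : TangentBundle (𝓡 n) M)) x := by
    filter_upwards [eventually_mem_nhds_iff.2 hs] with x hx using hsm.contMDiffAt hx
  have hz : ContDiffAt ℝ ∞ z p := (contMDiffAt_iff_coordField hy).1 hZ.self_of_nhds
  have hA : DifferentiableAt ℝ A p := (contDiffAt_christoffel cov hy).differentiableAt (by simp)
  have hzd : DifferentiableAt ℝ z p := hz.differentiableAt (by simp)
  have hdz : DifferentiableAt ℝ (fderiv ℝ z) p :=
    (hz.fderiv_right (m := 1) (by norm_cast)).differentiableAt (by simp)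
  -- The first covariant derivative along a coordinate field, as a function near `p`, so that it can
  -- be differentiated again.
  have hW (v : Model n) : coordField x₀ (fun x ↦ cov Z x (frame x₀ v x)) =ᶠ[𝓝 p]
      fun q ↦ fderiv ℝ z q v + A q v (z q) := by
    filter_upwards [(tendsto_extChartAt_symm hy).eventually hZ,
      (isOpen_target x₀).mem_nhds (extChartAt_mem_target hy)] with q hq hqt
    have hqs := extChartAt_symm_mem_source hqt
    have := toCoord_cov cov hqs (hq.mdifferentiableAt (by simp))
      (frame x₀ v ((extChartAt (𝓡 n) x₀).symm q))
    rwa [(extChartAt (𝓡 n) x₀).right_inv hqt, frame, toCoord_ofCoord hqs] at this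
  have hWd (v : Model n) : HasFDerivAt (fun q ↦ fderiv ℝ z q v + A q v (z q))
      ((fderiv ℝ (fderiv ℝ z) p).flip v +
        ((A p v) ∘L fderiv ℝ z p + ((fderiv ℝ A p).flip v).flip (z p))) p := by
    have h1 : HasFDerivAt (fun q ↦ fderiv ℝ z q v) ((fderiv ℝ (fderiv ℝ z) p).flip v) p := by
      simpa using hdz.hasFDerivAt.clm_apply (hasFDerivAt_const v p)
    have h2 : HasFDerivAt (fun q ↦ A q v) ((fderiv ℝ A p).flip v) p := by
      simpa using hA.hasFDerivAt.clm_apply (hasFDerivAt_const v p)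
    exact h1.add (h2.clm_apply hzd.hasFDerivAt)
  have hWm (v : Model n) : MDifferentiableAt (𝓡 n) ((𝓡 n).prod 𝓘(ℝ, Model n))
      (fun x ↦ (TotalSpace.mk' (Model n) x (cov Z x (frame x₀ v x)) :
        TangentBundle (𝓡 n) M)) y := by
    rw [mdifferentiableAt_iff_coordField hy, (hW v).differentiableAt_iff]
    exact (hWd v).differentiableAt
  have key (u v : Model n) : toCoord x₀ y (cov (fun x ↦ cov Z x (frame x₀ v x)) y (frame x₀ u y)) =
      fderiv ℝ (fderiv ℝ z) p u v + (A p v (fderiv ℝ z p u) + fderiv ℝ A p u v (z p)) +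
        A p u (fderiv ℝ z p v + A p v (z p)) := by
    rw [toCoord_cov cov hy (hWm v), (hW v).fderiv_eq, (hWd v).fderiv, (hW v).self_of_nhds, frame,
      toCoord_ofCoord hy]
    rfl
  have hsymm := (hz.isSymmSndFDerivAt (by simp; norm_cast)).eq (toCoord x₀ y u) (toCoord x₀ y v)
  have hu : frame x₀ (toCoord x₀ y u) y = u := ofCoord_toCoord hy u
  have hv : frame x₀ (toCoord x₀ y v) y = v := ofCoord_toCoord hy v
  -- Tensoriality in the first two slots permits coordinate fields as extensions of `u` and `v`, so
  -- that the bracket term disappears.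
  have hR : curvature cov y w u v = curvatureOfFields cov (frame x₀ (toCoord x₀ y u))
      (frame x₀ (toCoord x₀ y v)) Z y := by
    conv_lhs => rw [← hu, ← hv]
    exact TensorialAt.mkHom₂_apply _ _ (mdifferentiableAt_frame hy _) (mdifferentiableAt_frame hy _)
  rw [hR, curvatureOfFields, mlieBracket_frame hy, map_zero, sub_zero, map_sub, key, key, hsymm]
  have hzp : z p = toCoord x₀ y w := by rw [← hwy]; exact coordField_extChartAt hy Z
  rw [hzp, coordCurvature]
  simp only [map_add, sub_apply, add_apply, mul_apply_eq_comp]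
  abel

end Smooth

end Connection

/-! ### Algebra of parallel endomorphism fields in coordinates. -/

section CoordSmoothParallel

variable {V : Type*} [NormedAddCommGroup V] [NormedSpace ℝ V]

/-- In coordinates, `τ` is smooth and parallel at `p`. -/
def CoordSmoothParallelAt (A : V → V →L[ℝ] V →L[ℝ] V) (τ : V → V →L[ℝ] V) (p : V) : Prop :=
  ContDiffAt ℝ ∞ τ p ∧ CoordParallelAt A τ p

variable {A : V → V →L[ℝ] V →L[ℝ] V} {τ τ' : V → V →L[ℝ] V} {p : V}

lemma CoordSmoothParallelAt.congr (h : CoordSmoothParallelAt A τ p) (he : τ =ᶠ[𝓝 p] τ') :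
    CoordSmoothParallelAt A τ' p :=
  ⟨h.1.congr_of_eventuallyEq he.symm, fun v ↦ by
    rw [← he.fderiv_eq, ← he.self_of_nhds]; exact h.2 v⟩

lemma CoordSmoothParallelAt.differentiableAt (h : CoordSmoothParallelAt A τ p) :
    DifferentiableAt ℝ τ p := h.1.differentiableAt (by simp)

lemma CoordSmoothParallelAt.const_smul (h : CoordSmoothParallelAt A τ p) (c : ℝ) :
    CoordSmoothParallelAt A (fun q ↦ c • τ q) p := by
  refine ⟨h.1.const_smul c, fun v ↦ ?_⟩
  have : HasFDerivAt (fun q ↦ c • τ q) _ p := h.differentiableAt.hasFDerivAt.const_smul c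
  rw [this.fderiv, smul_apply, h.2 v]
  simp [smul_sub]

lemma CoordSmoothParallelAt.sub (h : CoordSmoothParallelAt A τ p)
    (h' : CoordSmoothParallelAt A τ' p) : CoordSmoothParallelAt A (fun q ↦ τ q - τ' q) p := by
  refine ⟨h.1.sub h'.1, fun v ↦ ?_⟩
  have : HasFDerivAt (fun q ↦ τ q - τ' q) _ p :=
    h.differentiableAt.hasFDerivAt.sub h'.differentiableAt.hasFDerivAt
  rw [this.fderiv, sub_apply, h.2 v, h'.2 v]
  noncomm_ring

lemma CoordSmoothParallelAt.mul (h : CoordSmoothParallelAt A τ p)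
    (h' : CoordSmoothParallelAt A τ' p) : CoordSmoothParallelAt A (fun q ↦ τ q * τ' q) p := by
  refine ⟨h.1.clm_comp h'.1, fun v ↦ ?_⟩
  have : HasFDerivAt (fun q ↦ τ q * τ' q) _ p :=
    h.differentiableAt.hasFDerivAt.mul' h'.differentiableAt.hasFDerivAt
  rw [this.fderiv]
  simp [h.2 v, h'.2 v]
  noncomm_ring

lemma coordSmoothParallelAt_one : CoordSmoothParallelAt A (fun _ ↦ 1) p :=
  ⟨contDiffAt_const, fun v ↦ by simp⟩

lemma CoordSmoothParallelAt.eventually_eq (hA : ContinuousAt A p)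
    (h : ∀ᶠ q in 𝓝 p, CoordSmoothParallelAt A τ q)
    (h' : ∀ᶠ q in 𝓝 p, CoordSmoothParallelAt A τ' q) (he : τ p = τ' p) : τ =ᶠ[𝓝 p] τ' := by
  have hs : ∀ᶠ q in 𝓝 p, CoordSmoothParallelAt A (fun q ↦ τ q - τ' q) q := by
    filter_upwards [h, h'] with q hq hq' using hq.sub hq'
  have := CoordParallelAt.eventually_eq_zero hA (hs.mono fun q hq ↦ hq.differentiableAt)
    (hs.mono fun q hq ↦ hq.2) (by simp [he])
  filter_upwards [this] with q hq using sub_eq_zero.1 hq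

end CoordSmoothParallel

/-! ### Parallel endomorphism fields on a manifold. -/

section SmoothParallel

variable {n : ℕ} {M : Type*} [TopologicalSpace M] [ChartedSpace (Model n) M]
  [IsManifold (𝓡 n) ∞ M] {x₀ y : M}
  {T T' : Π x : M, TangentSpace (𝓡 n) x →L[ℝ] TangentSpace (𝓡 n) x}

lemma coordEnd_apply (p v : Model n) :
    coordEnd x₀ T p v = toCoord x₀ ((extChartAt (𝓡 n) x₀).symm p)
      (T ((extChartAt (𝓡 n) x₀).symm p) (ofCoord x₀ ((extChartAt (𝓡 n) x₀).symm p) v)) :=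
  rfl

lemma apply_ofCoord (hy : y ∈ (chartAt (Model n) x₀).source) (v : TangentSpace (𝓡 n) y) :
    T y v = ofCoord x₀ y (coordEnd x₀ T (extChartAt (𝓡 n) x₀ y) (toCoord x₀ y v)) := by
  rw [coordEnd_extChartAt hy, ofCoord_toCoord hy, ofCoord_toCoord hy]

lemma eq_iff_coordEnd_eq (hy : y ∈ (chartAt (Model n) x₀).source) :
    T y = T' y ↔
      coordEnd x₀ T (extChartAt (𝓡 n) x₀ y) = coordEnd x₀ T' (extChartAt (𝓡 n) x₀ y) := by
  constructor
  · intro h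
    ext1 v
    rw [coordEnd_extChartAt hy, coordEnd_extChartAt hy, h]
  · intro h
    ext1 v
    rw [apply_ofCoord hy, apply_ofCoord hy, h]

lemma coordEnd_comp {p : Model n} (hp : p ∈ (extChartAt (𝓡 n) x₀).target) :
    coordEnd x₀ (fun x ↦ T x ∘L T' x) p = coordEnd x₀ T p * coordEnd x₀ T' p := by
  ext1 v
  rw [mul_apply_eq_comp, coordEnd_apply, coordEnd_apply, coordEnd_apply,
    ofCoord_toCoord (extChartAt_symm_mem_source hp)]
  rfl

lemma coordEnd_id {p : Model n} (hp : p ∈ (extChartAt (𝓡 n) x₀).target) :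
    coordEnd x₀ (fun x : M ↦ ContinuousLinearMap.id ℝ (TangentSpace (𝓡 n) x)) p = 1 := by
  ext1 v
  exact toCoord_ofCoord (extChartAt_symm_mem_source hp) v

lemma coordEnd_smul (c : ℝ) (p : Model n) :
    coordEnd x₀ (fun x ↦ c • T x) p = c • coordEnd x₀ T p := by
  ext1 v
  exact map_smul (toCoord x₀ ((extChartAt (𝓡 n) x₀).symm p)) c _

variable (cov : CovariantDerivative (𝓡 n) (Model n) (TangentSpace (𝓡 n) : M → Type _))

/-- The covariant derivative of an endomorphism field in coordinates. -/
lemma toCoord_cov_endomorphism (hy : y ∈ (chartAt (Model n) x₀).source)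
    (hT : DifferentiableAt ℝ (coordEnd x₀ T) (extChartAt (𝓡 n) x₀ y))
    {Z : Π x : M, TangentSpace (𝓡 n) x}
    (hZ : MDifferentiableAt (𝓡 n) ((𝓡 n).prod 𝓘(ℝ, Model n))
      (fun x ↦ (TotalSpace.mk' (Model n) x (Z x) : TangentBundle (𝓡 n) M)) y)
    (v : TangentSpace (𝓡 n) y) :
    toCoord x₀ y (cov (fun x ↦ T x (Z x)) y v - T y (cov Z y v)) =
      (fderiv ℝ (coordEnd x₀ T) (extChartAt (𝓡 n) x₀ y) (toCoord x₀ y v)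
        + christoffel cov x₀ (extChartAt (𝓡 n) x₀ y) (toCoord x₀ y v)
          * coordEnd x₀ T (extChartAt (𝓡 n) x₀ y)
        - coordEnd x₀ T (extChartAt (𝓡 n) x₀ y) *
          christoffel cov x₀ (extChartAt (𝓡 n) x₀ y) (toCoord x₀ y v)) (toCoord x₀ y (Z y)) := by
  set p := extChartAt (𝓡 n) x₀ y with hp
  set τ := coordEnd x₀ T
  have hz := (mdifferentiableAt_iff_coordField hy).1 hZ
  have hTZ : coordField x₀ (fun x ↦ T x (Z x)) =ᶠ[𝓝 p] fun q ↦ τ q (coordField x₀ Z q) := by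
    filter_upwards [(isOpen_target x₀).mem_nhds (extChartAt_mem_target hy)] with q hq
    rw [coordField, coordField, coordEnd_apply, ofCoord_toCoord (extChartAt_symm_mem_source hq)]
  have hd : HasFDerivAt (fun q ↦ τ q (coordField x₀ Z q)) _ p :=
    hT.hasFDerivAt.clm_apply hz.hasFDerivAt
  have hTZm : MDifferentiableAt (𝓡 n) ((𝓡 n).prod 𝓘(ℝ, Model n))
      (fun x ↦ (TotalSpace.mk' (Model n) x (T x (Z x)) : TangentBundle (𝓡 n) M)) y := by
    rw [mdifferentiableAt_iff_coordField hy, hTZ.differentiableAt_iff]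
    exact hd.differentiableAt
  have h2 : toCoord x₀ y (T y (cov Z y v)) = τ p (toCoord x₀ y (cov Z y v)) := by
    rw [hp, coordEnd_extChartAt hy, ofCoord_toCoord hy]
  rw [map_sub, h2, toCoord_cov cov hy hTZm, toCoord_cov cov hy hZ, hTZ.fderiv_eq, hd.fderiv,
    hTZ.self_of_nhds, ← coordField_extChartAt hy Z]
  simp only [add_apply, sub_apply, mul_apply_eq_comp, map_add, ContinuousLinearMap.comp_apply,
    ContinuousLinearMap.flip_apply]
  abel

/-- `T` is smooth and parallel at `y`. -/
def SmoothParallelAt (T : Π x : M, TangentSpace (𝓡 n) x →L[ℝ] TangentSpace (𝓡 n) x) (y : M) :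
    Prop :=
  ContMDiffAt (𝓡 n) ((𝓡 n).prod 𝓘(ℝ, Model n →L[ℝ] Model n)) ∞
    (fun x ↦ TotalSpace.mk' (Model n →L[ℝ] Model n)
      (E := fun x : M ↦ TangentSpace (𝓡 n) x →L[ℝ] TangentSpace (𝓡 n) x) x (T x)) y ∧
  ∀ Y : Π x : M, TangentSpace (𝓡 n) x, SmoothVectorField Y → ∀ v : TangentSpace (𝓡 n) y,
    cov (fun x ↦ T x (Y x)) y v - T y (cov Y y v) = 0

variable [T2Space M]

/-- The expression `∇_v (T Y) - T (∇_v Y)` depends only on the value of `Y` at `y`, and every value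
is attained by a global smooth field, namely a cut off coordinate field. -/
lemma smoothParallelAt_iff (hy : y ∈ (chartAt (Model n) x₀).source) :
    SmoothParallelAt cov T y ↔
      CoordSmoothParallelAt (christoffel cov x₀) (coordEnd x₀ T) (extChartAt (𝓡 n) x₀ y) := by
  rw [SmoothParallelAt, CoordSmoothParallelAt, contMDiffAt_iff_coordEnd hy]
  refine and_congr_right fun hT ↦ ?_
  have hTd : DifferentiableAt ℝ (coordEnd x₀ T) (extChartAt (𝓡 n) x₀ y) :=
    hT.differentiableAt (by simp)
  constructor
  · intro h v
    have hc : fderiv ℝ (coordEnd x₀ T) (extChartAt (𝓡 n) x₀ y) v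
        + christoffel cov x₀ (extChartAt (𝓡 n) x₀ y) v * coordEnd x₀ T (extChartAt (𝓡 n) x₀ y)
        - coordEnd x₀ T (extChartAt (𝓡 n) x₀ y) * christoffel cov x₀ (extChartAt (𝓡 n) x₀ y) v
        = 0 := by
      ext1 w
      obtain ⟨Y, hY, hYw⟩ := exists_smoothVectorField_eventuallyEq_frame hy w
      have h1 := toCoord_cov_endomorphism cov hy hTd ((hY y).mdifferentiableAt (by simp))
        (ofCoord x₀ y v)
      rw [h Y hY, map_zero, hYw.self_of_nhds, frame, toCoord_ofCoord hy, toCoord_ofCoord hy] at h1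
      exact h1.symm
    rw [← sub_eq_zero, ← hc]
    abel
  · intro h Y hY v
    have h1 := toCoord_cov_endomorphism cov hy hTd ((hY y).mdifferentiableAt (by simp)) v
    rw [h (toCoord x₀ y v)] at h1
    rw [← ofCoord_toCoord hy (cov (fun x ↦ T x (Y x)) y v - T y (cov Y y v)), h1]
    simp

lemma eventually_smoothParallelAt_iff (hy : y ∈ (chartAt (Model n) x₀).source) :
    (∀ᶠ x in 𝓝 y, SmoothParallelAt cov T x) ↔
      ∀ᶠ q in 𝓝 (extChartAt (𝓡 n) x₀ y),
        CoordSmoothParallelAt (christoffel cov x₀) (coordEnd x₀ T) q := by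
  constructor
  · intro h
    filter_upwards [(tendsto_extChartAt_symm hy).eventually h,
      (isOpen_target x₀).mem_nhds (extChartAt_mem_target hy)] with q hq hqt
    rw [smoothParallelAt_iff cov (extChartAt_symm_mem_source hqt)] at hq
    rwa [(extChartAt (𝓡 n) x₀).right_inv hqt] at hq
  · intro h
    filter_upwards [(tendsto_extChartAt hy).eventually h, source_mem_nhds hy] with x hx hxs
    exact (smoothParallelAt_iff cov hxs).2 hx

variable {cov}

lemma SmoothParallelAt.const_smul (h : SmoothParallelAt cov T y) (c : ℝ) :
    SmoothParallelAt cov (fun x ↦ c • T x) y := by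
  have hy := mem_chart_source (Model n) y
  rw [smoothParallelAt_iff cov hy] at h ⊢
  refine (h.const_smul c).congr ?_
  filter_upwards with q using (coordEnd_smul c q).symm

lemma SmoothParallelAt.comp (h : SmoothParallelAt cov T y) (h' : SmoothParallelAt cov T' y) :
    SmoothParallelAt cov (fun x ↦ T x ∘L T' x) y := by
  have hy := mem_chart_source (Model n) y
  rw [smoothParallelAt_iff cov hy] at h h' ⊢
  refine (h.mul h').congr ?_
  filter_upwards [(isOpen_target y).mem_nhds (extChartAt_mem_target hy)] with q hq
    using (coordEnd_comp hq).symm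

lemma smoothParallelAt_id :
    SmoothParallelAt cov (fun x : M ↦ ContinuousLinearMap.id ℝ (TangentSpace (𝓡 n) x)) y := by
  have hy := mem_chart_source (Model n) y
  rw [smoothParallelAt_iff cov hy]
  refine coordSmoothParallelAt_one.congr ?_
  filter_upwards [(isOpen_target y).mem_nhds (extChartAt_mem_target hy)] with q hq
    using (coordEnd_id hq).symm

omit [T2Space M] in
lemma SmoothParallelAt.congr (h : SmoothParallelAt cov T y) (he : ∀ᶠ x in 𝓝 y, T x = T' x)
    [T2Space M] : SmoothParallelAt cov T' y := by
  have hy := mem_chart_source (Model n) y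
  rw [smoothParallelAt_iff cov hy] at h ⊢
  refine h.congr ?_
  filter_upwards [(tendsto_extChartAt_symm hy).eventually he] with q hq
  rw [coordEnd, coordEnd, hq]

/-- Parallel endomorphism fields agreeing at a point agree nearby. -/
lemma eventually_eq_of_smoothParallelAt [hcov : cov.ContMDiffCovariantDerivative ∞]
    (h : ∀ᶠ x in 𝓝 y, SmoothParallelAt cov T x) (h' : ∀ᶠ x in 𝓝 y, SmoothParallelAt cov T' x)
    (he : T y = T' y) : ∀ᶠ x in 𝓝 y, T x = T' x := by
  have hy := mem_chart_source (Model n) y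
  rw [eventually_smoothParallelAt_iff cov hy] at h h'
  have := CoordSmoothParallelAt.eventually_eq (contDiffAt_christoffel cov hy).continuousAt h h'
    ((eq_iff_coordEnd_eq hy).1 he)
  filter_upwards [(tendsto_extChartAt hy).eventually this, source_mem_nhds hy] with x hx hxs
  exact (eq_iff_coordEnd_eq hxs).2 hx

lemma eventually_ne_of_smoothParallelAt (h : SmoothParallelAt cov T y)
    (h' : SmoothParallelAt cov T' y)
    (he : T y ≠ T' y) : ∀ᶠ x in 𝓝 y, T x ≠ T' x := by
  have hy := mem_chart_source (Model n) y
  rw [smoothParallelAt_iff cov hy] at h h'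
  have := h.1.continuousAt.ne_iff_eventually_ne h'.1.continuousAt |>.1
    ((eq_iff_coordEnd_eq hy).not.1 he)
  filter_upwards [(tendsto_extChartAt hy).eventually this, source_mem_nhds hy] with x hx hxs
  exact (eq_iff_coordEnd_eq hxs).not.2 hx

/-- Parallel endomorphism fields on a connected manifold agreeing at a point agree. -/
lemma eq_of_smoothParallelAt [PreconnectedSpace M] [hcov : cov.ContMDiffCovariantDerivative ∞]
    (h : ∀ x, SmoothParallelAt cov T x) (h' : ∀ x, SmoothParallelAt cov T' x)
    (he : T y = T' y) (x : M) : T x = T' x := by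
  -- The coincidence set is open by uniqueness for the linear equation along segments, and closed by
  -- continuity.
  have ho : IsOpen {x | T x = T' x} := isOpen_iff_mem_nhds.2 fun x hx ↦
    eventually_eq_of_smoothParallelAt (.of_forall h) (.of_forall h') hx
  have hc : IsClosed {x | T x = T' x} := by
    rw [← isOpen_compl_iff]
    exact isOpen_iff_mem_nhds.2 fun x hx ↦ eventually_ne_of_smoothParallelAt (h x) (h' x) hx
  have := IsClopen.eq_univ ⟨hc, ho⟩ ⟨y, he⟩
  exact (this ▸ mem_univ x : x ∈ {x | T x = T' x})

end SmoothParallel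

/-! ### Area form, trace and curvature operator in the plane. -/

section Plane

/-- The standard area form of the plane. -/
def planeArea : Model 2 →L[ℝ] Model 2 →L[ℝ] ℝ :=
  (EuclideanSpace.proj 0 : Model 2 →L[ℝ] ℝ).smulRight (EuclideanSpace.proj 1 : Model 2 →L[ℝ] ℝ) -
    (EuclideanSpace.proj 1 : Model 2 →L[ℝ] ℝ).smulRight (EuclideanSpace.proj 0 : Model 2 →L[ℝ] ℝ)

lemma planeArea_apply (u v : Model 2) : planeArea u v = u 0 * v 1 - u 1 * v 0 := by
  simp [planeArea]

/-- The trace of an endomorphism of the plane. -/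
def planeTrace : (Model 2 →L[ℝ] Model 2) →L[ℝ] ℝ :=
  (EuclideanSpace.proj 0 : Model 2 →L[ℝ] ℝ) ∘L
      ContinuousLinearMap.apply ℝ (Model 2) (EuclideanSpace.single 0 (1 : ℝ)) +
    (EuclideanSpace.proj 1 : Model 2 →L[ℝ] ℝ) ∘L
      ContinuousLinearMap.apply ℝ (Model 2) (EuclideanSpace.single 1 (1 : ℝ))

lemma planeTrace_apply (L : Model 2 →L[ℝ] Model 2) :
    planeTrace L = L (EuclideanSpace.single 0 1) 0 + L (EuclideanSpace.single 1 1) 1 := by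
  simp [planeTrace]

lemma plane_eq (u : Model 2) :
    u = u 0 • EuclideanSpace.single 0 (1 : ℝ) + u 1 • EuclideanSpace.single 1 (1 : ℝ) := by
  ext i
  fin_cases i <;> simp

lemma plane_apply (L : Model 2 →L[ℝ] Model 2) (u : Model 2) (i : Fin 2) :
    L u i = u 0 * L (EuclideanSpace.single 0 1) i + u 1 * L (EuclideanSpace.single 1 1) i := by
  conv_lhs => rw [plane_eq u]
  simp

/-- The infinitesimal form of `planeArea (L u) (L v) = det L * planeArea u v`. -/
lemma planeArea_apply_left_add (L : Model 2 →L[ℝ] Model 2) (u v : Model 2) :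
    planeArea (L u) v + planeArea u (L v) = planeTrace L * planeArea u v := by
  simp only [planeArea_apply, planeTrace_apply, plane_apply L u, plane_apply L v]
  ring

lemma plane_endomorphism_eq_of_planeArea {L L' : Model 2 →L[ℝ] Model 2}
    (h : ∀ a b, planeArea (L b) a = planeArea (L' b) a) : L = L' := by
  ext b i
  have h0 := h (EuclideanSpace.single 0 1) b
  have h1 := h (EuclideanSpace.single 1 1) b
  simp [planeArea_apply] at h0 h1
  fin_cases i
  · exact h1
  · exact h0

/-- The trace free part of the curvature operator of the coordinate fields. -/
def coordRicciEnd (A : Model 2 → Model 2 →L[ℝ] Model 2 →L[ℝ] Model 2) (p : Model 2) :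
    Model 2 →L[ℝ] Model 2 :=
  coordCurvature A p (EuclideanSpace.single 0 1) (EuclideanSpace.single 1 1) -
    (planeTrace (coordCurvature A p (EuclideanSpace.single 0 1)
      (EuclideanSpace.single 1 1)) / 2) • 1

variable {A : Model 2 → Model 2 →L[ℝ] Model 2 →L[ℝ] Model 2} {p : Model 2}

/-- The curvature is alternating in its two form arguments, and a plane has only one alternating
form up to scale. -/
lemma coordCurvature_eq_planeArea_smul (u v : Model 2) :
    coordCurvature A p u v = planeArea u v •
      coordCurvature A p (EuclideanSpace.single 0 1) (EuclideanSpace.single 1 1) := by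
  conv_lhs => rw [plane_eq u, plane_eq v]
  simp only [coordCurvature, planeArea_apply, map_add, map_smul, add_apply, smul_apply, mul_add,
    add_mul, smul_mul_assoc, mul_smul_comm]
  module

/-- Every curvature operator is a multiple of one endomorphism, which differs from `coordRicciEnd A
p` by a scalar matrix. -/
lemma coordRicciEnd_commute {τ : Model 2 →L[ℝ] Model 2} :
    (∀ u v, coordCurvature A p u v * τ = τ * coordCurvature A p u v) ↔
      coordRicciEnd A p * τ = τ * coordRicciEnd A p := by
  have h1 : coordRicciEnd A p * τ - τ * coordRicciEnd A p =
      coordCurvature A p (EuclideanSpace.single 0 1) (EuclideanSpace.single 1 1) * τ -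
      τ * coordCurvature A p (EuclideanSpace.single 0 1) (EuclideanSpace.single 1 1) := by
    simp only [coordRicciEnd, sub_mul, mul_sub, smul_mul_assoc, mul_smul_comm, one_mul, mul_one]
    abel
  rw [← sub_eq_zero (b := τ * coordRicciEnd A p), h1, sub_eq_zero]
  constructor
  · intro h
    exact h _ _
  · intro h u v
    rw [coordCurvature_eq_planeArea_smul u v, smul_mul_assoc, h, mul_smul_comm]

lemma planeTrace_coordRicciEnd : planeTrace (coordRicciEnd A p) = 0 := by
  have h1 : planeTrace (1 : Model 2 →L[ℝ] Model 2) = 2 := by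
    rw [planeTrace_apply]; norm_num
  rw [coordRicciEnd, map_sub, map_smul, h1, smul_eq_mul]
  ring

lemma contDiffOn_coordRicciEnd {U : Set (Model 2)} (hU : IsOpen U) (hA : ContDiffOn ℝ ∞ A U) :
    ContDiffOn ℝ ∞ (coordRicciEnd A) U := by
  have hd : ContDiffOn ℝ ∞ (fderiv ℝ A) U := hA.fderiv_of_isOpen hU (by simp)
  have hR (u v : Model 2) : ContDiffOn ℝ ∞ (fun p ↦ coordCurvature A p u v) U := by
    have h1 (u v : Model 2) : ContDiffOn ℝ ∞ (fun p ↦ fderiv ℝ A p u v) U :=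
      (hd.clm_apply contDiffOn_const).clm_apply contDiffOn_const
    have h2 (u : Model 2) : ContDiffOn ℝ ∞ (fun p ↦ A p u) U := hA.clm_apply contDiffOn_const
    exact (((h1 u v).sub (h1 v u)).add ((h2 u).clm_comp (h2 v))).sub ((h2 v).clm_comp (h2 u))
  exact (hR _ _).sub (((planeTrace.contDiff.comp_contDiffOn (hR _ _)).div_const 2).smul
    contDiffOn_const)

end Plane

/-! ### The Ricci tensor as an endomorphism paired with the area form. -/

section Ricci

variable {M : Type*} [TopologicalSpace M] [ChartedSpace (Model 2) M]
  [IsManifold (𝓡 2) ∞ M] {x₀ y : M}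

/-- The coordinate basis of the tangent space at `y` in the chart at `x₀`. -/
def chartBasis (hy : y ∈ (chartAt (Model 2) x₀).source) :
    Module.Basis (Fin 2) ℝ (TangentSpace (𝓡 2) y) :=
  (EuclideanSpace.basisFun (Fin 2) ℝ).toBasis.map
    (LinearEquiv.ofLinearMap (ofCoord x₀ y).toLinearMap (toCoord x₀ y).toLinearMap
      (LinearMap.ext fun v ↦ ofCoord_toCoord hy v) (LinearMap.ext fun v ↦ toCoord_ofCoord hy v))

lemma chartBasis_apply (hy : y ∈ (chartAt (Model 2) x₀).source) (i : Fin 2) :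
    chartBasis hy i = ofCoord x₀ y (EuclideanSpace.single i 1) := by
  simp [chartBasis]

lemma chartBasis_repr (hy : y ∈ (chartAt (Model 2) x₀).source) (v : TangentSpace (𝓡 2) y)
    (i : Fin 2) : (chartBasis hy).repr v i = toCoord x₀ y v i := by
  simp [chartBasis]

variable [T2Space M]
  (cov : CovariantDerivative (𝓡 2) (Model 2) (TangentSpace (𝓡 2) : M → Type _))
  [hcov : cov.ContMDiffCovariantDerivative ∞]

/-- Take the trace in the coordinate basis: by `R(z, u) = α(z, u) R₁₂` it is `∑ α(eᵢ, u) (R₁₂ v)ᵢ =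
α(R₁₂ v, u)`. -/
lemma ricci_eq (hy : y ∈ (chartAt (Model 2) x₀).source) (u v : TangentSpace (𝓡 2) y) :
    ricci cov y u v = planeArea (coordCurvature (christoffel cov x₀) (extChartAt (𝓡 2) x₀ y)
      (EuclideanSpace.single 0 1) (EuclideanSpace.single 1 1) (toCoord x₀ y v))
      (toCoord x₀ y u) := by
  have h (i : Fin 2) : toCoord x₀ y (curvatureEndomorphism cov y u v (chartBasis hy i)) =
      coordCurvature (christoffel cov x₀) (extChartAt (𝓡 2) x₀ y) (EuclideanSpace.single i 1)
        (toCoord x₀ y u) (toCoord x₀ y v) := by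
    have h1 (z : TangentSpace (𝓡 2) y) :
        curvatureEndomorphism cov y u v z = curvature cov y v z u :=
      rfl
    rw [chartBasis_apply, h1, toCoord_curvature cov hy, toCoord_ofCoord hy]
  have h2 : ricci cov y u v = LinearMap.trace ℝ _ (curvatureEndomorphism cov y u v) := rfl
  rw [h2, trace_eq_of_basis (chartBasis hy), chartBasis_repr, chartBasis_repr, h, h,
    coordCurvature_eq_planeArea_smul _ (toCoord x₀ y u),
    coordCurvature_eq_planeArea_smul (EuclideanSpace.single 1 1) (toCoord x₀ y u)]
  simp [planeArea_apply]
  ring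

/-- The symmetric Ricci tensor in coordinates. -/
lemma ricciSymm_eq (hy : y ∈ (chartAt (Model 2) x₀).source) (u v : TangentSpace (𝓡 2) y) :
    ricciSymm cov y u v = planeArea (coordRicciEnd (christoffel cov x₀) (extChartAt (𝓡 2) x₀ y)
      (toCoord x₀ y v)) (toCoord x₀ y u) := by
  have h : ricciSymm cov y u v = 1 / 2 * (ricci cov y u v + ricci cov y v u) := by
    simp [ricciSymm]
    ring
  rw [h, ricci_eq cov hy, ricci_eq cov hy, coordRicciEnd]
  -- This trace identity shows that symmetrizing `α(R₁₂ v, u)` amounts to removing half the trace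
  -- from `R₁₂`.
  have h1 := planeArea_apply_left_add (coordCurvature (christoffel cov x₀) (extChartAt (𝓡 2) x₀ y)
      (EuclideanSpace.single 0 1) (EuclideanSpace.single 1 1)) (toCoord x₀ y v) (toCoord x₀ y u)
  simp only [planeArea_apply, sub_apply, smul_apply, one_apply_eq_self, PiLp.sub_apply,
    PiLp.smul_apply, smul_eq_mul] at h1 ⊢
  linarith

lemma ricciSymm_symm (y : M) (u v : TangentSpace (𝓡 2) y) :
    ricciSymm cov y u v = ricciSymm cov y v u := by
  simp [ricciSymm, add_comm]

end Ricci

/-! ### From a parallel endomorphism field to recurrence, in coordinates. -/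

section PlaneRecurrence

variable {A : Model 2 → Model 2 →L[ℝ] Model 2 →L[ℝ] Model 2} {p : Model 2}
  {S τ : Model 2 → Model 2 →L[ℝ] Model 2}

/-- The covariant derivative of the endomorphism field `S` in coordinates. -/
def coordCovEnd (A : Model 2 → Model 2 →L[ℝ] Model 2 →L[ℝ] Model 2)
    (S : Model 2 → Model 2 →L[ℝ] Model 2) (p : Model 2) :
    Model 2 →L[ℝ] Model 2 →L[ℝ] Model 2 :=
  fderiv ℝ S p + (ContinuousLinearMap.mul ℝ (Model 2 →L[ℝ] Model 2)).flip (S p) ∘L A p -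
    ContinuousLinearMap.mul ℝ (Model 2 →L[ℝ] Model 2) (S p) ∘L A p

lemma coordCovEnd_apply (v : Model 2) :
    coordCovEnd A S p v = fderiv ℝ S p v + A p v * S p - S p * A p v := by
  simp [coordCovEnd]

lemma contDiffOn_coordCovEnd {U : Set (Model 2)} (hU : IsOpen U) (hA : ContDiffOn ℝ ∞ A U)
    (hS : ContDiffOn ℝ ∞ S U) : ContDiffOn ℝ ∞ (coordCovEnd A S) U := by
  have hd : ContDiffOn ℝ ∞ (fderiv ℝ S) U := hS.fderiv_of_isOpen hU (by simp)
  have h1 : ContDiffOn ℝ ∞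
      (fun q ↦ (ContinuousLinearMap.mul ℝ (Model 2 →L[ℝ] Model 2)).flip (S q)) U :=
    (ContinuousLinearMap.contDiff _).comp_contDiffOn hS
  have h2 : ContDiffOn ℝ ∞ (fun q ↦ ContinuousLinearMap.mul ℝ (Model 2 →L[ℝ] Model 2) (S q)) U :=
    (ContinuousLinearMap.contDiff _).comp_contDiffOn hS
  exact (hd.add (h1.clm_comp hA)).sub (h2.clm_comp hA)

lemma planeTrace_eq_trace (L : Model 2 →L[ℝ] Model 2) :
    planeTrace L = LinearMap.trace ℝ (Model 2) L.toLinearMap := by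
  rw [trace_eq_of_basis (EuclideanSpace.basisFun (Fin 2) ℝ).toBasis, planeTrace_apply]
  simp

lemma planeTrace_mul_comm (L L' : Model 2 →L[ℝ] Model 2) :
    planeTrace (L * L') = planeTrace (L' * L) := by
  rw [planeTrace_eq_trace, planeTrace_eq_trace]
  exact LinearMap.trace_mul_comm ℝ L.toLinearMap L'.toLinearMap

lemma exists_eq_smul_of_planeTrace {L L' : Model 2 →L[ℝ] Model 2} (hL : planeTrace L = 0)
    (hL' : planeTrace L' = 0) (hc : L * L' = L' * L) (h0 : L ≠ 0) : ∃ c : ℝ, L' = c • L := by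
  rw [planeTrace_eq_trace] at hL hL'
  obtain ⟨c, hc⟩ := exists_eq_smul_of_commute (EuclideanSpace.basisFun (Fin 2) ℝ).toBasis hL hL'
    (fun v ↦ congrArg (fun f : Model 2 →L[ℝ] Model 2 ↦ f v) hc)
    (fun h ↦ h0 (ContinuousLinearMap.coe_injective h))
  exact ⟨c, ContinuousLinearMap.coe_injective hc⟩

/-- A trace free endomorphism field commuting with a parallel one is recurrent. -/
lemma exists_coordCovEnd_eq_smul (hS : DifferentiableAt ℝ S p) (hS0 : S p ≠ 0)
    (hSt : ∀ᶠ q in 𝓝 p, planeTrace (S q) = 0) (hτ : CoordSmoothParallelAt A τ p)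
    (hτt : planeTrace (τ p) = 0) (hτ0 : τ p ≠ 0) (hc : ∀ᶠ q in 𝓝 p, S q * τ q = τ q * S q)
    (v : Model 2) : ∃ c : ℝ, coordCovEnd A S p v = c • S p := by
  have hτd := hτ.differentiableAt
  -- Differentiate `S τ = τ S`. As `∇τ = 0`, this will give `[τ, ∇_v S] = 0`.
  have hD : fderiv ℝ S p v * τ p + S p * fderiv ℝ τ p v =
      fderiv ℝ τ p v * S p + τ p * fderiv ℝ S p v := by
    have h1 : HasFDerivAt (fun q ↦ S q * τ q) _ p := hS.hasFDerivAt.mul' hτd.hasFDerivAt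
    have h2 : HasFDerivAt (fun q ↦ τ q * S q) _ p := hτd.hasFDerivAt.mul' hS.hasFDerivAt
    have h3 := (h1.congr_of_eventuallyEq (EventuallyEq.symm hc)).unique h2
    have := congrArg (fun f : Model 2 →L[ℝ] Model 2 →L[ℝ] Model 2 ↦ f v) h3
    simp only [add_apply, smul_apply, smul_eq_mul, MulOpposite.smul_eq_mul_unop,
      MulOpposite.unop_op] at this
    rw [add_comm, this, add_comm]
  have hT : planeTrace (fderiv ℝ S p v) = 0 := by
    have h1 : HasFDerivAt (fun q ↦ planeTrace (S q)) (planeTrace ∘L fderiv ℝ S p) p :=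
      planeTrace.hasFDerivAt.comp p hS.hasFDerivAt
    have h2 := (h1.congr_of_eventuallyEq (EventuallyEq.symm hSt)).unique (hasFDerivAt_const 0 p)
    exact congrArg (fun f : Model 2 →L[ℝ] ℝ ↦ f v) h2
  have hNt : planeTrace (coordCovEnd A S p v) = 0 := by
    rw [coordCovEnd_apply, map_sub, map_add, hT, planeTrace_mul_comm]
    ring
  have hNc : τ p * coordCovEnd A S p v = coordCovEnd A S p v * τ p := by
    have hcp := hc.self_of_nhds
    rw [hτ.2 v] at hD
    rw [coordCovEnd_apply, ← sub_eq_zero]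
    have e : τ p * (fderiv ℝ S p v + A p v * S p - S p * A p v) -
        (fderiv ℝ S p v + A p v * S p - S p * A p v) * τ p =
        ((τ p * A p v - A p v * τ p) * S p + τ p * fderiv ℝ S p v
          - (fderiv ℝ S p v * τ p + S p * (τ p * A p v - A p v * τ p)))
        + ((S p * τ p - τ p * S p) * A p v - A p v * (S p * τ p - τ p * S p)) := by
      noncomm_ring
    rw [e, hD, hcp]
    simp
  -- Both `∇_v S` and `S` are trace free and commute with `τ`, hence are multiples of `τ`; the
  -- multiple for `S` is nonzero, so it can be divided out.
  obtain ⟨c, hc1⟩ := exists_eq_smul_of_planeTrace hτt hNt hNc hτ0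
  obtain ⟨d, hd⟩ := exists_eq_smul_of_planeTrace hτt hSt.self_of_nhds hc.self_of_nhds.symm hτ0
  have hd0 : d ≠ 0 := by
    rintro rfl
    exact hS0 (by rw [hd, zero_smul])
  exact ⟨c / d, by rw [hc1, hd, smul_smul, div_mul_cancel₀ c hd0]⟩

end PlaneRecurrence

/-! ### Recurrence of the symmetric Ricci tensor and of its endomorphism. -/

section Recurrence

variable {M : Type*} [TopologicalSpace M] [ChartedSpace (Model 2) M]
  [IsManifold (𝓡 2) ∞ M] {x₀ y : M} [T2Space M]
  (cov : CovariantDerivative (𝓡 2) (Model 2) (TangentSpace (𝓡 2) : M → Type _))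
  [hcov : cov.ContMDiffCovariantDerivative ∞]

/-- The endomorphism field representing the symmetric Ricci tensor in the chart at `x₀`. -/
def chartRicciEnd (x₀ : M) (p : Model 2) : Model 2 →L[ℝ] Model 2 :=
  coordRicciEnd (christoffel cov x₀) p

variable (x₀) in
lemma contDiffOn_chartRicciEnd :
    ContDiffOn ℝ ∞ (chartRicciEnd cov x₀) (extChartAt (𝓡 2) x₀).target :=
  contDiffOn_coordRicciEnd (isOpen_target x₀) (contDiffOn_christoffel x₀ cov)

lemma contDiffAt_chartRicciEnd (hy : y ∈ (chartAt (Model 2) x₀).source) :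
    ContDiffAt ℝ ∞ (chartRicciEnd cov x₀) (extChartAt (𝓡 2) x₀ y) :=
  (contDiffOn_chartRicciEnd x₀ cov).contDiffAt
    ((isOpen_target x₀).mem_nhds (extChartAt_mem_target hy))

lemma chartRicciEnd_ne_zero (hy : y ∈ (chartAt (Model 2) x₀).source)
    (h : ricciSymm cov y ≠ 0) : chartRicciEnd cov x₀ (extChartAt (𝓡 2) x₀ y) ≠ 0 := by
  intro h0
  refine h (LinearMap.ext₂ fun u v ↦ ?_)
  rw [chartRicciEnd] at h0
  rw [ricciSymm_eq cov hy, h0]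
  simp

/-- The covariant derivative of the symmetric Ricci tensor in coordinates. -/
lemma cov_ricciSymm_eq (hy : y ∈ (chartAt (Model 2) x₀).source)
    {Y Z : Π x : M, TangentSpace (𝓡 2) x} (hY : SmoothVectorField Y) (hZ : SmoothVectorField Z)
    (v : TangentSpace (𝓡 2) y) :
    mvfderiv (𝓡 2) (fun x ↦ ricciSymm cov x (Y x) (Z x)) y v
      - ricciSymm cov y (cov Y y v) (Z y) - ricciSymm cov y (Y y) (cov Z y v) =
    planeArea ((coordCovEnd (christoffel cov x₀) (chartRicciEnd cov x₀) (extChartAt (𝓡 2) x₀ y)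
        (toCoord x₀ y v)
      - planeTrace (christoffel cov x₀ (extChartAt (𝓡 2) x₀ y) (toCoord x₀ y v)) •
        chartRicciEnd cov x₀ (extChartAt (𝓡 2) x₀ y)) (toCoord x₀ y (Z y)))
          (toCoord x₀ y (Y y)) := by
  have hYd := (hY y).mdifferentiableAt (n := ∞) (by simp)
  have hZd := (hZ y).mdifferentiableAt (n := ∞) (by simp)
  have hyd := (mdifferentiableAt_iff_coordField hy).1 hYd
  have hzd := (mdifferentiableAt_iff_coordField hy).1 hZd
  have hS : DifferentiableAt ℝ (chartRicciEnd cov x₀) (extChartAt (𝓡 2) x₀ y) :=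
    (contDiffAt_chartRicciEnd cov hy).differentiableAt (by simp)
  set p := extChartAt (𝓡 2) x₀ y
  have he : (fun x ↦ ricciSymm cov x (Y x) (Z x)) ∘ (extChartAt (𝓡 2) x₀).symm =ᶠ[𝓝 p]
      fun q ↦ planeArea (chartRicciEnd cov x₀ q (coordField x₀ Z q)) (coordField x₀ Y q) := by
    filter_upwards [(isOpen_target x₀).mem_nhds (extChartAt_mem_target hy)] with q hq
    have := ricciSymm_eq cov (extChartAt_symm_mem_source hq)
      (Y ((extChartAt (𝓡 2) x₀).symm q)) (Z ((extChartAt (𝓡 2) x₀).symm q))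
    rwa [(extChartAt (𝓡 2) x₀).right_inv hq] at this
  have hd : HasFDerivAt
      (fun q ↦ planeArea (chartRicciEnd cov x₀ q (coordField x₀ Z q)) (coordField x₀ Y q)) _ p :=
    (planeArea.hasFDerivAt.comp p (hS.hasFDerivAt.clm_apply hzd.hasFDerivAt)).clm_apply
      hyd.hasFDerivAt
  have hm : MDifferentiableAt (𝓡 2) 𝓘(ℝ, ℝ) (fun x ↦ ricciSymm cov x (Y x) (Z x)) y := by
    rw [mdifferentiableAt_iff_comp_symm hy, he.differentiableAt_iff]
    exact hd.differentiableAt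
  rw [mvfderiv_eq_fderiv_comp_symm hy hm, he.fderiv_eq, hd.fderiv, ricciSymm_eq cov hy,
    ricciSymm_eq cov hy, toCoord_cov cov hy hYd, toCoord_cov cov hy hZd, ← coordField_extChartAt hy,
    ← coordField_extChartAt hy, coordCovEnd_apply]
  -- This is `∇_v α = -tr(A v) α` for the area form of the chart, the source of the trace
  -- correction.
  have ht := planeArea_apply_left_add (christoffel cov x₀ p (toCoord x₀ y v))
    (chartRicciEnd cov x₀ p (coordField x₀ Z p)) (coordField x₀ Y p)
  simp only [add_apply, sub_apply, smul_apply, mul_apply_eq_comp, map_add, map_sub, map_smul,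
    ContinuousLinearMap.comp_apply, ContinuousLinearMap.flip_apply, smul_eq_mul,
    Function.comp_apply]
    at ht ⊢
  change _ - (planeArea (chartRicciEnd cov x₀ p _) _ + planeArea (chartRicciEnd cov x₀ p _) _) -
    (planeArea (chartRicciEnd cov x₀ p _) _ + planeArea (chartRicciEnd cov x₀ p _) _) = _
  linarith

/-- `∇ρ_s = η ⊗ ρ_s` at `y`. -/
def RicciRecurrentAt (y : M) (η : TangentSpace (𝓡 2) y →L[ℝ] ℝ) : Prop :=
  ∀ Y Z : Π x : M, TangentSpace (𝓡 2) x, SmoothVectorField Y → SmoothVectorField Z →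
    ∀ v : TangentSpace (𝓡 2) y,
      mvfderiv (𝓡 2) (fun x ↦ ricciSymm cov x (Y x) (Z x)) y v
        - ricciSymm cov y (cov Y y v) (Z y) - ricciSymm cov y (Y y) (cov Z y v) =
      η v * ricciSymm cov y (Y y) (Z y)

lemma ricciRecurrentAt_iff (hy : y ∈ (chartAt (Model 2) x₀).source)
    {η : TangentSpace (𝓡 2) y →L[ℝ] ℝ} :
    RicciRecurrentAt cov y η ↔ ∀ v : Model 2,
      coordCovEnd (christoffel cov x₀) (chartRicciEnd cov x₀) (extChartAt (𝓡 2) x₀ y) v =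
        (η (ofCoord x₀ y v) + planeTrace (christoffel cov x₀ (extChartAt (𝓡 2) x₀ y) v)) •
          chartRicciEnd cov x₀ (extChartAt (𝓡 2) x₀ y) := by
  constructor
  · intro h v
    have hL : coordCovEnd (christoffel cov x₀) (chartRicciEnd cov x₀) (extChartAt (𝓡 2) x₀ y) v -
        planeTrace (christoffel cov x₀ (extChartAt (𝓡 2) x₀ y) v) •
          chartRicciEnd cov x₀ (extChartAt (𝓡 2) x₀ y) =
        η (ofCoord x₀ y v) • chartRicciEnd cov x₀ (extChartAt (𝓡 2) x₀ y) := by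
      refine plane_endomorphism_eq_of_planeArea fun a b ↦ ?_
      obtain ⟨Y, hY, hYa⟩ := exists_smoothVectorField_eventuallyEq_frame hy a
      obtain ⟨Z, hZ, hZb⟩ := exists_smoothVectorField_eventuallyEq_frame hy b
      have h1 := cov_ricciSymm_eq cov hy hY hZ (ofCoord x₀ y v)
      rw [h Y Z hY hZ, ricciSymm_eq cov hy, hYa.self_of_nhds, hZb.self_of_nhds, frame, frame,
        toCoord_ofCoord hy, toCoord_ofCoord hy, toCoord_ofCoord hy] at h1
      rw [← h1]
      simp [chartRicciEnd]
    rw [add_smul, ← hL]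
    abel
  · intro h Y Z hY hZ v
    rw [cov_ricciSymm_eq cov hy hY hZ v, h, ofCoord_toCoord hy, add_smul, add_sub_cancel_right,
      ricciSymm_eq cov hy]
    simp [chartRicciEnd]

/-- Uniqueness is what makes locally constructed recurrence forms agree on overlaps. -/
lemma RicciRecurrentAt.unique {η η' : TangentSpace (𝓡 2) y →L[ℝ] ℝ}
    (h : RicciRecurrentAt cov y η) (h' : RicciRecurrentAt cov y η') (h0 : ricciSymm cov y ≠ 0) :
    η = η' := by
  have hy := mem_chart_source (Model 2) y
  ext1 v
  have h1 := (ricciRecurrentAt_iff cov hy).1 h (toCoord y y v)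
  rw [(ricciRecurrentAt_iff cov hy).1 h' (toCoord y y v), ofCoord_toCoord hy] at h1
  have := smul_left_injective ℝ (chartRicciEnd_ne_zero cov hy h0) h1
  simpa using this.symm

/-- In a chart, the endomorphism field representing a recurrent symmetric Ricci tensor is
recurrent. -/
lemma exists_coordRecurrentAt_of_isRecurrent (h : IsRecurrent cov (ricciSymm cov)) (x₀ : M) :
    ∃ β : Model 2 → Model 2 →L[ℝ] ℝ, ContDiffOn ℝ ∞ β (extChartAt (𝓡 2) x₀).target ∧
      ∀ q ∈ (extChartAt (𝓡 2) x₀).target,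
        CoordRecurrentAt (christoffel cov x₀) β (chartRicciEnd cov x₀) q := by
  obtain ⟨η, hη, h⟩ := h
  have hp : ContDiffOn ℝ ∞ (fun q ↦ planeTrace ∘L christoffel cov x₀ q)
      (extChartAt (𝓡 2) x₀).target := contDiffOn_const.clm_comp (contDiffOn_christoffel x₀ cov)
  -- The trace of the connection form compensates for the area form of the chart not being parallel.
  refine ⟨fun q ↦ coordForm x₀ η q + planeTrace ∘L christoffel cov x₀ q,
    ContDiffOn.add (fun q hq ↦ ?_) hp, fun q hq v ↦ ?_⟩
  · have := (contMDiffAt_iff_coordForm (extChartAt_symm_mem_source hq)).1 (hη _)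
    rw [(extChartAt (𝓡 2) x₀).right_inv hq] at this
    exact this.contDiffWithinAt
  · have hq' := extChartAt_symm_mem_source hq
    have h1 := (ricciRecurrentAt_iff cov hq').1 (fun Y Z hY hZ v ↦ h Y Z hY hZ _ v) v
    rw [← coordForm_extChartAt hq', (extChartAt (𝓡 2) x₀).right_inv hq, coordCovEnd_apply] at h1
    rw [add_apply, ContinuousLinearMap.comp_apply, ← h1]
    abel

/-- The proportionality factors need no regularity assumption: near each point the factor is a
quotient of components of `∇S` and `S`, hence smooth, and uniqueness of the recurrence form makes
the local forms into a global one. -/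
lemma isRecurrent_of_exists_smul (h0 : ∀ x, ricciSymm cov x ≠ 0)
    (h : ∀ x₀ : M, ∀ y ∈ (chartAt (Model 2) x₀).source, ∀ v : Model 2, ∃ c : ℝ,
      coordCovEnd (christoffel cov x₀) (chartRicciEnd cov x₀) (extChartAt (𝓡 2) x₀ y) v =
        c • chartRicciEnd cov x₀ (extChartAt (𝓡 2) x₀ y)) :
    IsRecurrent cov (ricciSymm cov) := by
  have key (x₀ : M) : ∃ ζ : Model 2 → Model 2 →L[ℝ] ℝ,
      ContDiffAt ℝ ∞ ζ (extChartAt (𝓡 2) x₀ x₀) ∧ ∀ᶠ y in 𝓝 x₀,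
        RicciRecurrentAt cov y (ζ (extChartAt (𝓡 2) x₀ y) ∘L toCoord x₀ y) := by
    have hx := mem_chart_source (Model 2) x₀
    obtain ⟨a, b, hab⟩ : ∃ a b,
        planeArea (chartRicciEnd cov x₀ (extChartAt (𝓡 2) x₀ x₀) b) a ≠ 0 := by
      by_contra! hc
      exact chartRicciEnd_ne_zero cov hx (h0 x₀)
        (plane_endomorphism_eq_of_planeArea fun a b ↦ (hc a b).trans (by simp))
    have hr : ContDiffAt ℝ ∞ (fun q ↦ planeArea (chartRicciEnd cov x₀ q b) a)
        (extChartAt (𝓡 2) x₀ x₀) :=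
      (contDiffAt_const.clm_apply ((contDiffAt_chartRicciEnd cov hx).clm_apply
        contDiffAt_const)).clm_apply contDiffAt_const
    have hN : ContDiffAt ℝ ∞ (coordCovEnd (christoffel cov x₀) (chartRicciEnd cov x₀))
        (extChartAt (𝓡 2) x₀ x₀) :=
      (contDiffOn_coordCovEnd (isOpen_target x₀) (contDiffOn_christoffel x₀ cov)
        (contDiffOn_chartRicciEnd x₀ cov)).contDiffAt
        ((isOpen_target x₀).mem_nhds (extChartAt_mem_target hx))
    set L : (Model 2 →L[ℝ] Model 2) →L[ℝ] ℝ :=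
      (planeArea.flip a) ∘L ContinuousLinearMap.apply ℝ (Model 2) b with hL
    have hLa (X : Model 2 →L[ℝ] Model 2) : L X = planeArea (X b) a := by simp [hL]
    -- Divide the `(a, b)` component of `∇S` by that of `S`, which is nonzero near the centre, then
    -- subtract the trace of the connection form to return from `S` to `ρ_s`.
    refine ⟨fun q ↦ (planeArea (chartRicciEnd cov x₀ q b) a)⁻¹ •
      (L ∘L coordCovEnd (christoffel cov x₀) (chartRicciEnd cov x₀) q) -
        planeTrace ∘L christoffel cov x₀ q,
      ((hr.inv hab).smul (contDiffAt_const.clm_comp hN)).sub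
        (contDiffAt_const.clm_comp (contDiffAt_christoffel cov hx)), ?_⟩
    filter_upwards [(tendsto_extChartAt hx).eventually (hr.continuousAt.eventually_ne hab),
      source_mem_nhds hx] with y hyr hy
    rw [ricciRecurrentAt_iff cov hy]
    intro v
    obtain ⟨c, hc⟩ := h x₀ y hy v
    simp only [ContinuousLinearMap.comp_apply, toCoord_ofCoord hy, sub_apply, smul_apply, hc, hLa,
      sub_add_cancel, map_smul, smul_eq_mul]
    rw [mul_left_comm, inv_mul_cancel₀ hyr, mul_one]
  have hex (x : M) : ∃ η : TangentSpace (𝓡 2) x →L[ℝ] ℝ, RicciRecurrentAt cov x η := by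
    obtain ⟨ζ, -, hζ⟩ := key x
    exact ⟨_, hζ.self_of_nhds⟩
  choose η hη using hex
  refine ⟨η, fun x₀ ↦ ?_, fun Y Z hY hZ x v ↦ hη x Y Z hY hZ v⟩
  have hx := mem_chart_source (Model 2) x₀
  rw [contMDiffAt_iff_coordForm hx]
  obtain ⟨ζ, hζs, hζ⟩ := key x₀
  refine hζs.congr_of_eventuallyEq ?_
  filter_upwards [(tendsto_extChartAt_symm hx).eventually hζ,
    (isOpen_target x₀).mem_nhds (extChartAt_mem_target hx)] with q hq hqt
  have hq' := extChartAt_symm_mem_source hqt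
  ext1 v
  change η ((extChartAt (𝓡 2) x₀).symm q) (ofCoord x₀ _ v) = _
  rw [(hη _).unique cov hq (h0 _), ContinuousLinearMap.comp_apply, toCoord_ofCoord hq',
    (extChartAt (𝓡 2) x₀).right_inv hqt]

end Recurrence

/-! ### Locally constant cocycles over a simply connected space. -/

section Gluing

variable {X ι F : Type*} [TopologicalSpace X]

/-- A fibre bundle core whose transition functions are locally constant. -/
def locallyConstantCore [TopologicalSpace F] [DiscreteTopology F] (U : ι → Set X)
    (hU : ∀ i, IsOpen (U i)) (idx : X → ι) (hidx : ∀ x, x ∈ U (idx x)) (g : ι → ι → X → F → F)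
    (hself : ∀ i, ∀ x ∈ U i, ∀ a, g i i x a = a)
    (hcomp : ∀ i j k, ∀ x ∈ U i ∩ U j ∩ U k, ∀ a, g j k x (g i j x a) = g i k x a)
    (hloc : ∀ i j, ∀ x ∈ U i ∩ U j, ∀ᶠ y in 𝓝 x, g i j y = g i j x) :
    FiberBundleCore ι X F where
  baseSet := U
  isOpen_baseSet := hU
  indexAt := idx
  mem_baseSet_at := hidx
  coordChange := g
  coordChange_self := hself
  continuousOn_coordChange i j := by
    rintro ⟨x, a⟩ ⟨hx, -⟩
    refine ContinuousAt.continuousWithinAt ?_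
    have : ∀ᶠ p : X × F in 𝓝 (x, a), g i j p.1 p.2 = g i j x p.2 :=
      ((continuous_fst.tendsto (x, a)).eventually (hloc i j x hx)).mono
        fun p hp ↦ congrFun hp p.2
    exact (continuous_of_discreteTopology.comp continuous_snd).continuousAt.congr
      (EventuallyEq.symm this)
  coordChange_comp := hcomp

/-- Compatible families for locally constant transition functions exist over a simply connected
space. -/
lemma exists_locallyConstant_section [SimplyConnectedSpace X] [LocallyPathConnectedSpace X]
    [Nonempty F] (U : ι → Set X)
    (hU : ∀ i, IsOpen (U i)) (idx : X → ι) (hidx : ∀ x, x ∈ U (idx x)) (g : ι → ι → X → F → F)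
    (hself : ∀ i, ∀ x ∈ U i, ∀ a, g i i x a = a)
    (hcomp : ∀ i j k, ∀ x ∈ U i ∩ U j ∩ U k, ∀ a, g j k x (g i j x a) = g i k x a)
    (hloc : ∀ i j, ∀ x ∈ U i ∩ U j, ∀ᶠ y in 𝓝 x, g i j y = g i j x) :
    ∃ c : ι → X → F, (∀ i j, ∀ x ∈ U i ∩ U j, c j x = g i j x (c i x)) ∧
      ∀ i, ∀ x ∈ U i, ∀ᶠ y in 𝓝 x, c i y = c i x := by
  -- With discrete fibre, the bundle with these transition functions is a covering space, and over a
  -- simply connected base the identity lifts to a section.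
  let _ : TopologicalSpace F := ⊥
  have : DiscreteTopology F := ⟨rfl⟩
  let Z := locallyConstantCore U hU idx hidx g hself hcomp hloc
  have hcov : IsCoveringMap (TotalSpace.proj : TotalSpace F Z.Fiber → X) :=
    FiberBundle.isCoveringMap
  obtain ⟨x₀⟩ : Nonempty X := inferInstance
  obtain ⟨a₀⟩ := ‹Nonempty F›
  obtain ⟨s, ⟨-, hs⟩, -⟩ := hcov.existsUnique_continuousMap_lifts (ContinuousMap.id X) x₀
    (⟨x₀, a₀⟩ : TotalSpace F Z.Fiber) rfl
  have hs' (x : X) : (s x).proj = x := congrFun hs x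
  -- The family consists of the readings of the section in the local trivializations; they are
  -- continuous with discrete values, hence locally constant.
  refine ⟨fun i x ↦ (Z.localTriv i (s x)).2, fun i j x hx ↦ ?_, fun i x hx ↦ ?_⟩
  · simp only [FiberBundleCore.localTriv_apply, hs']
    exact (hcomp (idx x) i j x ⟨⟨hidx x, hx.1⟩, hx.2⟩ _).symm
  · have hc : ContinuousAt (fun y ↦ (Z.localTriv i (s y)).2) x := by
      refine continuousAt_snd.comp (ContinuousAt.comp ?_ s.continuous.continuousAt)
      exact (Z.localTriv i).toOpenPartialHomeomorph.continuousAt (by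
        change s x ∈ (Z.localTriv i).source
        rw [(Z.localTriv i).mem_source]
        change (s x).proj ∈ U i
        rwa [hs'])
    exact hc.eventually (isOpen_discrete {(Z.localTriv i (s x)).2} |>.mem_nhds rfl)

end Gluing

/-! ### A global parallel endomorphism field from recurrence. -/

section ParallelSection

variable {M : Type*} [TopologicalSpace M] [ChartedSpace (Model 2) M]
  [IsManifold (𝓡 2) ∞ M] {x₀ y : M}

/-- The area form of a chart. -/
def chartArea (x₀ y : M) : LinearMap.BilinForm ℝ (TangentSpace (𝓡 2) y) :=
  LinearMap.mk₂ ℝ (fun u v ↦ planeArea (toCoord x₀ y u) (toCoord x₀ y v))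
    (fun u u' v ↦ by simp only [map_add, add_apply])
    (fun c u v ↦ by simp only [map_smul, smul_apply])
    (fun u v v' ↦ by simp only [map_add])
    (fun c u v ↦ by simp only [map_smul])

lemma chartArea_apply (u v : TangentSpace (𝓡 2) y) :
    chartArea x₀ y u v = planeArea (toCoord x₀ y u) (toCoord x₀ y v) := rfl

lemma chartArea_isAlt : (chartArea x₀ y).IsAlt := fun u ↦ by
  rw [chartArea_apply, planeArea_apply]
  ring

lemma chartArea_ne_zero (hy : y ∈ (chartAt (Model 2) x₀).source) : chartArea x₀ y ≠ 0 := by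
  intro h
  have := congrArg (fun B : LinearMap.BilinForm ℝ (TangentSpace (𝓡 2) y) ↦
    B (ofCoord x₀ y (EuclideanSpace.single 0 1)) (ofCoord x₀ y (EuclideanSpace.single 1 1))) h
  simp only [chartArea_apply, toCoord_ofCoord hy, planeArea_apply] at this
  simp at this

variable [T2Space M]
  (cov : CovariantDerivative (𝓡 2) (Model 2) (TangentSpace (𝓡 2) : M → Type _))
  [hcov : cov.ContMDiffCovariantDerivative ∞]

lemma represents_chartRicciEnd (hy : y ∈ (chartAt (Model 2) x₀).source) :
    Represents (ricciSymm cov y) (ofCoord x₀ y ∘L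
      chartRicciEnd cov x₀ (extChartAt (𝓡 2) x₀ y) ∘L toCoord x₀ y).toLinearMap := by
  refine ⟨chartArea x₀ y, chartArea_isAlt, chartArea_ne_zero hy, fun u v ↦ ?_⟩
  rw [ricciSymm_eq cov hy, chartArea_apply]
  exact congrArg (fun w ↦ planeArea w (toCoord x₀ y u)) (toCoord_ofCoord hy _).symm

/-- If the symmetric Ricci tensor is recurrent, it is locally represented by parallel
endomorphism fields. -/
lemma exists_local_parallel_represents (h0 : ∀ x, ricciSymm cov x ≠ 0)
    (h : IsRecurrent cov (ricciSymm cov)) (x₀ : M) :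
    ∃ (U : Set M) (T : Π x : M, TangentSpace (𝓡 2) x →L[ℝ] TangentSpace (𝓡 2) x),
      IsOpen U ∧ x₀ ∈ U ∧ ∀ y ∈ U, SmoothParallelAt cov T y ∧
        Represents (ricciSymm cov y) (T y).toLinearMap := by
  obtain ⟨β, hβ, hrec⟩ := exists_coordRecurrentAt_of_isRecurrent cov h x₀
  have hx := mem_chart_source (Model 2) x₀
  -- A ball in the chart provides the convexity needed for the Poincaré lemma.
  obtain ⟨ε, hε, hball⟩ := Metric.isOpen_iff.1 (isOpen_target x₀) _ (extChartAt_mem_target hx)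
  set D := Metric.ball (extChartAt (𝓡 2) x₀ x₀) ε with hD
  obtain ⟨g, hg0, hgs, hgp⟩ := exists_contDiffOn_smul_parallel (A := christoffel cov x₀)
    (β := β) (τ := chartRicciEnd cov x₀) Metric.isOpen_ball (convex_ball _ _)
    (((contDiffOn_christoffel x₀ cov).differentiableOn (by simp)).mono hball)
    (hβ.mono hball) ((contDiffOn_chartRicciEnd x₀ cov).mono hball)
    (fun q hq ↦ hrec q (hball hq))
    (fun q hq hq0 ↦ by
      have hq' := extChartAt_symm_mem_source (hball hq)
      have := chartRicciEnd_ne_zero cov hq' (h0 _)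
      rw [(extChartAt (𝓡 2) x₀).right_inv (hball hq)] at this
      exact this hq0)
    (fun q _ ↦ coordRicciEnd_commute.2 rfl)
  refine ⟨(chartAt (Model 2) x₀).source ∩ extChartAt (𝓡 2) x₀ ⁻¹' D,
    fun y ↦ ofCoord x₀ y ∘L (g (extChartAt (𝓡 2) x₀ y) •
      chartRicciEnd cov x₀ (extChartAt (𝓡 2) x₀ y)) ∘L toCoord x₀ y, ?_,
    ⟨hx, Metric.mem_ball_self hε⟩, fun y ⟨hy, hyD⟩ ↦ ⟨?_, ?_⟩⟩
  · refine isOpen_iff_mem_nhds.2 fun y ⟨hy, hyD⟩ ↦ ?_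
    exact inter_mem (source_mem_nhds hy)
      ((tendsto_extChartAt hy) (Metric.isOpen_ball.mem_nhds hyD))
  · rw [smoothParallelAt_iff cov hy]
    have hs : CoordSmoothParallelAt (christoffel cov x₀) (fun q ↦ g q • chartRicciEnd cov x₀ q)
        (extChartAt (𝓡 2) x₀ y) :=
      ⟨hgs.contDiffAt (Metric.isOpen_ball.mem_nhds hyD), hgp _ hyD⟩
    refine hs.congr ?_
    filter_upwards [(isOpen_target x₀).mem_nhds (extChartAt_mem_target hy)] with q hq
    have hq' := extChartAt_symm_mem_source hq
    ext1 v
    rw [coordEnd_apply]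
    simp only [ContinuousLinearMap.comp_apply]
    rw [toCoord_ofCoord hq', toCoord_ofCoord hq', (extChartAt (𝓡 2) x₀).right_inv hq]
  · convert (represents_chartRicciEnd cov hy).smul (hg0 (extChartAt (𝓡 2) x₀ y)) using 1
    refine LinearMap.ext fun v ↦ ?_
    exact map_smul (ofCoord (n := 2) x₀ y) _ _

/-- On a simply connected surface, if the symmetric Ricci tensor is recurrent, it is represented by
a global parallel endomorphism field. -/
lemma exists_parallel_represents [SimplyConnectedSpace M] (h0 : ∀ x, ricciSymm cov x ≠ 0)
    (h : IsRecurrent cov (ricciSymm cov)) :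
    ∃ T : Π x : M, TangentSpace (𝓡 2) x →L[ℝ] TangentSpace (𝓡 2) x,
      ∀ x, SmoothParallelAt cov T x ∧ Represents (ricciSymm cov x) (T x).toLinearMap := by
  have := ChartedSpace.locallyPathConnectedSpace (Model 2) M
  choose U T hUo hxU hT using exists_local_parallel_represents cov h0 h
  have hex (i j x : M) (hx : x ∈ U i ∩ U j) : ∃ c : ℝˣ, T i x = (c : ℝ) • T j x := by
    obtain ⟨c, hc, e⟩ := (hT j x hx.2).2.exists_eq_smul
      (chartBasis (mem_chart_source (Model 2) x)) (hT i x hx.1).2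
    exact ⟨Units.mk0 c hc, ContinuousLinearMap.coe_injective e⟩
  have hTne (i x : M) (hx : x ∈ U i) : T i x ≠ 0 := fun e ↦
    (hT i x hx).2.ne_zero (h0 x) (by rw [e]; rfl)
  have hinj (j x : M) (hx : x ∈ U j) {c d : ℝˣ} (e : (c : ℝ) • T j x = (d : ℝ) • T j x) :
      c = d := Units.ext (smul_left_injective ℝ (hTne j x hx) e)
  classical
  -- The value `1` off the overlap is arbitrary and never enters.
  let g (i j x : M) : ℝˣ := if hx : x ∈ U i ∩ U j then (hex i j x hx).choose else 1
  have hg (i j x : M) (hx : x ∈ U i ∩ U j) : T i x = (g i j x : ℝ) • T j x := by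
    simp only [g, dif_pos hx]
    exact (hex i j x hx).choose_spec
  -- Near `x`, both `T i` and the constant multiple `g i j x • T j` are parallel; as they agree at
  -- `x`, they agree nearby, so the ratio is locally constant.
  have hgloc (i j x : M) (hx : x ∈ U i ∩ U j) : ∀ᶠ y in 𝓝 x, g i j y = g i j x := by
    have hn := ((hUo i).inter (hUo j)).mem_nhds hx
    filter_upwards [hn, eventually_eq_of_smoothParallelAt (y := x) (T := T i)
      (T' := fun y ↦ (g i j x : ℝ) • T j y) (cov := cov)
      (by filter_upwards [hn] with y hy using (hT i y hy.1).1)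
      (by filter_upwards [hn] with y hy using (hT j y hy.2).1.const_smul _)
      (hg i j x hx)] with y hy e
    exact hinj j y hy.2 ((hg i j y hy).symm.trans e)
  -- From `T i = g i j • T j`, the fields `c i • T i` match on overlaps iff `c j = c i * g i j`;
  -- this dictates the transition maps on the fibre `ℝˣ`.
  obtain ⟨c, hc, hcloc⟩ := exists_locallyConstant_section (F := ℝˣ) U hUo id hxU
    (fun i j x a ↦ a * g i j x)
    (fun i x hx a ↦ by
      have : g i i x = 1 := hinj i x hx (by rw [← hg i i x ⟨hx, hx⟩]; simp)
      simp [this])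
    (fun i j k x hx a ↦ by
      have : g i j x * g j k x = g i k x := hinj k x hx.2 (by
        rw [← hg i k x ⟨hx.1.1, hx.2⟩, Units.val_mul, mul_smul, ← hg j k x ⟨hx.1.2, hx.2⟩,
          ← hg i j x hx.1])
      rw [mul_assoc, this])
    (fun i j x hx ↦ (hgloc i j x hx).mono fun y hy ↦ by rw [hy])
  have hcT (i j x : M) (hx : x ∈ U i ∩ U j) : (c i x : ℝ) • T i x = (c j x : ℝ) • T j x := by
    rw [hc i j x hx, hg i j x hx, Units.val_mul, mul_smul]
  refine ⟨fun x ↦ (c x x : ℝ) • T x x, fun x ↦ ⟨?_, (hT x x (hxU x)).2.smul (c x x).ne_zero⟩⟩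
  -- Near `x` the glued field is a constant multiple of the single local field `T x`, because `c x`
  -- is locally constant.
  refine ((hT x x (hxU x)).1.const_smul (c x x : ℝ)).congr ?_
  filter_upwards [(hUo x).mem_nhds (hxU x), hcloc x x (hxU x)] with y hy e
  rw [← e]
  exact hcT x y y ⟨hy, hxU y⟩

end ParallelSection

/-! ### The three types of Kähler structures. -/

section KahlerStructures

variable {M : Type*} [TopologicalSpace M] [ChartedSpace (Model 2) M]
  [IsManifold (𝓡 2) ∞ M] {x₀ y : M}
  {T : Π x : M, TangentSpace (𝓡 2) x →L[ℝ] TangentSpace (𝓡 2) x}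

lemma planeTrace_coordEnd (hy : y ∈ (chartAt (Model 2) x₀).source) :
    planeTrace (coordEnd x₀ T (extChartAt (𝓡 2) x₀ y)) =
      LinearMap.trace ℝ (TangentSpace (𝓡 2) y) (T y).toLinearMap := by
  rw [trace_eq_of_basis (chartBasis hy), planeTrace_apply, chartBasis_repr, chartBasis_repr,
    chartBasis_apply, chartBasis_apply, coordEnd_extChartAt hy, coordEnd_extChartAt hy]
  rfl

variable {cov : CovariantDerivative (𝓡 2) (Model 2) (TangentSpace (𝓡 2) : M → Type _)}

lemma IsTraceFreeParallel.smoothParallelAt (h : IsTraceFreeParallel cov T) (x : M) :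
    SmoothParallelAt cov T x :=
  ⟨h.smooth x, fun Y hY v ↦ h.parallel Y hY x v⟩

variable [T2Space M] [hcov : cov.ContMDiffCovariantDerivative ∞] (cov)

/-- A parallel field commutes with the curvature, which is the case `β = 0` of the Ricci identity.
-/
lemma chartRicciEnd_commute (h : ∀ x, SmoothParallelAt cov T x)
    (hy : y ∈ (chartAt (Model 2) x₀).source) :
    chartRicciEnd cov x₀ (extChartAt (𝓡 2) x₀ y) * coordEnd x₀ T (extChartAt (𝓡 2) x₀ y) =
      coordEnd x₀ T (extChartAt (𝓡 2) x₀ y) * chartRicciEnd cov x₀ (extChartAt (𝓡 2) x₀ y) := by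
  have hs := (eventually_smoothParallelAt_iff cov hy).1 (.of_forall h)
  exact coordRicciEnd_commute.1 fun u v ↦ coordCurvature_commute_of_parallel
    ((contDiffAt_christoffel cov hy).differentiableAt (by simp))
    (hs.self_of_nhds.1.of_le (by norm_cast)) (hs.mono fun q hq ↦ hq.2) u v

/-- A nowhere vanishing trace free parallel endomorphism field represents the symmetric Ricci
tensor. -/
lemma represents_of_parallel (h0 : ∀ x, ricciSymm cov x ≠ 0)
    (h : ∀ x, SmoothParallelAt cov T x)
    (htr : ∀ x, LinearMap.trace ℝ (TangentSpace (𝓡 2) x) (T x).toLinearMap = 0)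
    (hT0 : ∀ x, T x ≠ 0) (x : M) : Represents (ricciSymm cov x) (T x).toLinearMap := by
  have hx := mem_chart_source (Model 2) x
  refine (represents_chartRicciEnd cov hx).of_commute (chartBasis hx) (ricciSymm_symm cov x) (h0 x)
    (htr x) (fun v ↦ ?_) (fun e ↦ hT0 x (ContinuousLinearMap.coe_injective e))
  have hc := congrArg (fun L : Model 2 →L[ℝ] Model 2 ↦ ofCoord (n := 2) x x (L (toCoord x x v)))
    (chartRicciEnd_commute cov h hx)
  simp only [mul_apply_eq_comp, coordEnd_extChartAt hx, ofCoord_toCoord hx] at hc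
  exact hc

lemma isRecurrent_of_parallel (h0 : ∀ x, ricciSymm cov x ≠ 0)
    (h : ∀ x, SmoothParallelAt cov T x)
    (htr : ∀ x, LinearMap.trace ℝ (TangentSpace (𝓡 2) x) (T x).toLinearMap = 0)
    (hT0 : ∀ x, T x ≠ 0) : IsRecurrent cov (ricciSymm cov) := by
  refine isRecurrent_of_exists_smul cov h0 fun x₀ y hy v ↦ ?_
  have hT0' : coordEnd x₀ T (extChartAt (𝓡 2) x₀ y) ≠ 0 := by
    intro e
    refine hT0 y (ContinuousLinearMap.ext fun w ↦ ?_)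
    rw [apply_ofCoord hy, e]
    exact map_zero (ofCoord (n := 2) x₀ y)
  refine exists_coordCovEnd_eq_smul
    ((contDiffAt_chartRicciEnd cov hy).differentiableAt (by simp))
    (chartRicciEnd_ne_zero cov hy (h0 y)) (.of_forall fun q ↦ planeTrace_coordRicciEnd)
    ((smoothParallelAt_iff cov hy).1 (h y)) ((planeTrace_coordEnd hy).trans (htr y)) hT0' ?_ v
  filter_upwards [(isOpen_target x₀).mem_nhds (extChartAt_mem_target hy)] with q hq
  have := chartRicciEnd_commute cov h (extChartAt_symm_mem_source hq)
  rwa [(extChartAt (𝓡 2) x₀).right_inv hq] at this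

variable {cov}

/-- The trace vanishes because `ρ_s` is symmetric. -/
lemma isTraceFreeParallel_of_represents (h : ∀ x, SmoothParallelAt cov T x)
    (hr : ∀ x, Represents (ricciSymm cov x) (T x).toLinearMap) : IsTraceFreeParallel cov T where
  smooth x := (h x).1
  parallel Y hY x v := (h x).2 Y hY v
  traceFree x := (hr x).trace_eq_zero (chartBasis (mem_chart_source (Model 2) x))
    (ricciSymm_symm cov x)

variable (cov) in
/-- On a simply connected surface with recurrent symmetric Ricci tensor, the latter is represented
by a trace free parallel endomorphism field with constant square. -/
lemma exists_parallel_represents_sq [SimplyConnectedSpace M] (h0 : ∀ x, ricciSymm cov x ≠ 0)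
    (h : IsRecurrent cov (ricciSymm cov)) :
    ∃ (T : Π x : M, TangentSpace (𝓡 2) x →L[ℝ] TangentSpace (𝓡 2) x) (c : ℝ),
      (∀ x, SmoothParallelAt cov T x) ∧ (∀ x, Represents (ricciSymm cov x) (T x).toLinearMap) ∧
        ∀ x v, T x (T x v) = c • v := by
  obtain ⟨T, hT⟩ := exists_parallel_represents cov h0 h
  obtain ⟨x₀⟩ : Nonempty M := inferInstance
  have hx := mem_chart_source (Model 2) x₀
  obtain ⟨c, hsq⟩ : ∃ c : ℝ, ∀ v, T x₀ (T x₀ v) = c • v :=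
    ⟨_, apply_apply_of_trace_eq_zero (chartBasis hx)
      ((hT x₀).2.trace_eq_zero (chartBasis hx) (ricciSymm_symm cov x₀))⟩
  refine ⟨T, c, fun x ↦ (hT x).1, fun x ↦ (hT x).2, fun x v ↦ ?_⟩
  -- Both `T²` and `c • id` are parallel, so agreement at the one point `x₀` propagates over the
  -- connected surface.
  have e := eq_of_smoothParallelAt (cov := cov) (y := x₀) (T := fun x ↦ T x ∘L T x)
    (fun x ↦ (hT x).1.comp (hT x).1) (fun x ↦ smoothParallelAt_id.const_smul _)
    (ContinuousLinearMap.ext hsq) x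
  exact congrArg (fun L : TangentSpace (𝓡 2) x →L[ℝ] TangentSpace (𝓡 2) x ↦ L v) e

/-- Dividing `T` by `√|c|` leaves only the sign of `c` in the square. -/
lemma exists_isTraceFreeParallel_sq {c : ℝ} (hc : c ≠ 0)
    (h : ∀ x, SmoothParallelAt cov T x)
    (hr : ∀ x, Represents (ricciSymm cov x) (T x).toLinearMap)
    (hsq : ∀ x v, T x (T x v) = c • v) :
    ∃ T' : Π x : M, TangentSpace (𝓡 2) x →L[ℝ] TangentSpace (𝓡 2) x,
      IsTraceFreeParallel cov T' ∧ ∀ x v, T' x (T' x v) = (c / |c|) • v := by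
  have hs : √|c| ≠ 0 := (Real.sqrt_pos.2 (abs_pos.2 hc)).ne'
  refine ⟨fun x ↦ (√|c|)⁻¹ • T x, isTraceFreeParallel_of_represents
    (fun x ↦ (h x).const_smul _) (fun x ↦ (hr x).smul (inv_ne_zero hs)), fun x v ↦ ?_⟩
  have e : (√|c|)⁻¹ * (√|c|)⁻¹ * c = c / |c| := by
    rw [← mul_inv, Real.mul_self_sqrt (abs_nonneg c), div_eq_inv_mul]
  change (√|c|)⁻¹ • T x ((√|c|)⁻¹ • T x v) = _
  rw [map_smul, hsq, smul_smul, smul_smul, e]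

variable (cov)

/-- With `T² = c`, the determinant of `ρ_s` has the sign of `-c`. A Kähler structure has `c = -1`;
conversely the determinant at a single point already decides the sign of the constant `c`. -/
lemma admitsKahler_iff [SimplyConnectedSpace M] (h0 : ∀ x, ricciSymm cov x ≠ 0) :
    AdmitsKahler cov ↔
      (∀ x, ∀ b : Module.Basis (Fin 2) ℝ (TangentSpace (𝓡 2) x),
        0 < (LinearMap.BilinForm.toMatrix b (ricciSymm cov x)).det) ∧
        IsRecurrent cov (ricciSymm cov) := by
  constructor
  · rintro ⟨T, hT, hsq⟩
    have hT0 (x : M) : T x ≠ 0 := fun e ↦ by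
      have hb := (chartBasis (mem_chart_source (Model 2) x)).ne_zero 0
      have := hsq x (chartBasis (mem_chart_source (Model 2) x) 0)
      rw [e] at this
      exact hb (neg_eq_zero.1 this.symm)
    refine ⟨fun x b ↦ ?_, isRecurrent_of_parallel cov h0 hT.smoothParallelAt hT.traceFree hT0⟩
    obtain ⟨k, hk, e⟩ := (represents_of_parallel cov h0 hT.smoothParallelAt hT.traceFree hT0
      x).det_toMatrix b (ricciSymm_symm cov x) (c := -1) fun v ↦ (hsq x v).trans (by simp)
    rw [e]
    linarith
  · rintro ⟨hdet, h⟩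
    obtain ⟨T, c, hT, hr, hsq⟩ := exists_parallel_represents_sq cov h0 h
    obtain ⟨x⟩ : Nonempty M := inferInstance
    have b := chartBasis (mem_chart_source (Model 2) x)
    obtain ⟨k, hk, e⟩ := (hr x).det_toMatrix b (ricciSymm_symm cov x) (hsq x)
    have hd := hdet x b
    rw [e] at hd
    have hc : c < 0 := by
      by_contra! hc
      nlinarith [mul_nonneg hk.le hc]
    obtain ⟨T', hT', hsq'⟩ := exists_isTraceFreeParallel_sq hc.ne hT hr hsq
    refine ⟨T', hT', fun x v ↦ (hsq' x v).trans ?_⟩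
    rw [abs_of_neg hc, div_neg, div_self hc.ne, neg_one_smul]

lemma admitsParaKahler_iff [SimplyConnectedSpace M] (h0 : ∀ x, ricciSymm cov x ≠ 0) :
    AdmitsParaKahler cov ↔
      (∀ x, ∀ b : Module.Basis (Fin 2) ℝ (TangentSpace (𝓡 2) x),
        (LinearMap.BilinForm.toMatrix b (ricciSymm cov x)).det < 0) ∧
        IsRecurrent cov (ricciSymm cov) := by
  constructor
  · rintro ⟨T, hT, hsq⟩
    have hT0 (x : M) : T x ≠ 0 := fun e ↦ by
      have hb := (chartBasis (mem_chart_source (Model 2) x)).ne_zero 0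
      have := hsq x (chartBasis (mem_chart_source (Model 2) x) 0)
      rw [e] at this
      exact hb this.symm
    refine ⟨fun x b ↦ ?_, isRecurrent_of_parallel cov h0 hT.smoothParallelAt hT.traceFree hT0⟩
    obtain ⟨k, hk, e⟩ := (represents_of_parallel cov h0 hT.smoothParallelAt hT.traceFree hT0
      x).det_toMatrix b (ricciSymm_symm cov x) (c := 1) fun v ↦ (hsq x v).trans (by simp)
    rw [e]
    linarith
  · rintro ⟨hdet, h⟩
    obtain ⟨T, c, hT, hr, hsq⟩ := exists_parallel_represents_sq cov h0 h
    obtain ⟨x⟩ : Nonempty M := inferInstance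
    have b := chartBasis (mem_chart_source (Model 2) x)
    obtain ⟨k, hk, e⟩ := (hr x).det_toMatrix b (ricciSymm_symm cov x) (hsq x)
    have hd := hdet x b
    rw [e] at hd
    have hc : 0 < c := by
      by_contra! hc
      nlinarith [mul_nonneg hk.le (neg_nonneg.2 hc)]
    obtain ⟨T', hT', hsq'⟩ := exists_isTraceFreeParallel_sq hc.ne' hT hr hsq
    refine ⟨T', hT', fun x v ↦ (hsq' x v).trans ?_⟩
    rw [abs_of_pos hc, div_self hc.ne', one_smul]

lemma admitsNilpotentKahler_iff [SimplyConnectedSpace M] (h0 : ∀ x, ricciSymm cov x ≠ 0) :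
    AdmitsNilpotentKahler cov ↔
      (∀ x, (ricciSymm cov x).rank = 1) ∧ IsRecurrent cov (ricciSymm cov) := by
  constructor
  · rintro ⟨T, hT, hne, hsq⟩
    have hT0 (x : M) : T x ≠ 0 := fun e ↦ by
      -- A parallel field vanishing at one point agrees there with the parallel field `0 • id`,
      -- hence vanishes everywhere; so `T ≠ 0` as a field gives `T x ≠ 0` at every point.
      refine hne (funext fun z ↦ ?_)
      have := eq_of_smoothParallelAt (cov := cov) (y := x) hT.smoothParallelAt
        (fun x ↦ smoothParallelAt_id.const_smul 0) (by rw [e, zero_smul]) z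
      rw [this, zero_smul, Pi.zero_apply]
    refine ⟨fun x ↦ ?_, isRecurrent_of_parallel cov h0 hT.smoothParallelAt hT.traceFree hT0⟩
    have b := chartBasis (mem_chart_source (Model 2) x)
    obtain ⟨k, hk, e⟩ := (represents_of_parallel cov h0 hT.smoothParallelAt hT.traceFree hT0
      x).det_toMatrix b (ricciSymm_symm cov x) (c := 0) fun v ↦ (hsq x v).trans (by simp)
    rw [rank_eq_one_iff_det_eq_zero b (h0 x), e, mul_zero]
  · rintro ⟨hrank, h⟩
    obtain ⟨T, c, hT, hr, hsq⟩ := exists_parallel_represents_sq cov h0 h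
    obtain ⟨x⟩ : Nonempty M := inferInstance
    have b := chartBasis (mem_chart_source (Model 2) x)
    obtain ⟨k, hk, e⟩ := (hr x).det_toMatrix b (ricciSymm_symm cov x) (hsq x)
    rw [(rank_eq_one_iff_det_eq_zero b (h0 x)).1 (hrank x), eq_comm, mul_eq_zero,
      neg_eq_zero] at e
    -- A degenerate `ρ_s` forces `c = 0`, so `T` is already nilpotent and needs no rescaling.
    obtain rfl := e.resolve_left hk.ne'
    refine ⟨T, isTraceFreeParallel_of_represents hT hr, fun hz ↦ ?_,
      fun x v ↦ (hsq x v).trans (zero_smul ℝ v)⟩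
    exact (hr x).ne_zero (h0 x) (by rw [hz]; rfl)

end KahlerStructures

end AffineManifold

end

theorem theorem1p6 {M : Type*} [TopologicalSpace M] [T2Space M] [SecondCountableTopology M]
    [ChartedSpace (EuclideanSpace ℝ (Fin 2)) M] [IsManifold (𝓡 2) ∞ M]
    [SimplyConnectedSpace M]
    (cov : CovariantDerivative (𝓡 2) (EuclideanSpace ℝ (Fin 2)) (TangentSpace (𝓡 2) : M → Type _))
    [hcov : cov.ContMDiffCovariantDerivative ∞]
    (htorsion : cov.torsion = 0)
    (hricci : ∀ x, AffineManifold.ricciSymm cov x ≠ 0) :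
    (AffineManifold.AdmitsKahler cov ↔
      (∀ x, ∀ b : Module.Basis (Fin 2) ℝ (TangentSpace (𝓡 2) x),
        0 < (LinearMap.BilinForm.toMatrix b (AffineManifold.ricciSymm cov x)).det) ∧
        AffineManifold.IsRecurrent cov (AffineManifold.ricciSymm cov)) ∧
    (AffineManifold.AdmitsParaKahler cov ↔
      (∀ x, ∀ b : Module.Basis (Fin 2) ℝ (TangentSpace (𝓡 2) x),
        (LinearMap.BilinForm.toMatrix b (AffineManifold.ricciSymm cov x)).det < 0) ∧
        AffineManifold.IsRecurrent cov (AffineManifold.ricciSymm cov)) ∧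
    (AffineManifold.AdmitsNilpotentKahler cov ↔
      (∀ x, (AffineManifold.ricciSymm cov x).rank = 1) ∧ AffineManifold.IsRecurrent cov (AffineManifold.ricciSymm cov)) :=
  ⟨AffineManifold.admitsKahler_iff cov hricci, AffineManifold.admitsParaKahler_iff cov hricci,
    AffineManifold.admitsNilpotentKahler_iff cov hricci⟩
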